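/- There is a universal constant $C>0$ such that for every metric space $\mathcal{M}=(S,d)$ on $n\ge 2$ points (distinct points at distance $0$ being allowed) there exist a randomized online algorithm for MPMD on $\mathcal{M}$ and a randomized online algorithm for MBPMD on $\mathcal{M}$, both of which are $(C\log n)$-competitive. In particular, the competitive ratio does not depend on the aspect ratio of $\mathcal{M}$. Here an instance of MPMD (Min-cost Perfect Matching with Delays) is a sequence of requests $(p_1,t_1),\dots,(p_m,t_m)$ with $m$ even, $p_i\in S$ and real arrival times $t_1\le\cdots\le t_m$. In an instance of MBPMD (the bipartite variant) each request carries in addition a polarity $b_i\in\{+1,-1\}$, there are as many positive as negative requests, and only pairs $\{i,j\}$ with $b_ib_j=-1$ are allowed. A solution of an instance is a perfect matching of its requests into (allowed) pairs, and its cost is $\sum_{\{i,j\}}\bigl(d(p_i,p_j)+|t_i-t_j|\bigr)$, summed over its pairs. A deterministic online algorithm, which knows $\mathcal{M}$ in advance, outputs on every instance all pairs of a perfect matching, each pair $\{i,j\}$ at some time $t\ge\max(t_i,t_j)$, such that what has been output up to a time $t$ depends only on the requests that arrived up to time $t$; it pays $d(p_i,p_j)+(t-t_i)+(t-t_j)$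 for each pair $\{i,j\}$ output at time $t$. A randomized online algorithm is a random deterministic online algorithm. It is $\alpha$-competitive if, for every instance $I$ and every solution of $I$, its expected total cost on $I$ is at most $\alpha$ times the cost of that solution. -/

import Mathlib

open MeasureTheory
open scoped BigOperators

/-!  Online min-cost perfect matching with delays, plain (MPMD) and bipartite (MBPMD).  -/

noncomputable section

namespace MatchingWithDelays

universe u v

/-- What distinguishes the two variants of the problem.  Each request carries a label from `L`;
`compat a b` says that requests labelled `a` and `b` may be paired, and `admissible` says which
sequences of labels occur in an input. -/
structure Variant (L : Type v) where
  compat : L → L → Prop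
  admissible : List L → Prop

/-- MPMD: requests carry no information besides point and time, any two requests may be paired,
and the number of requests is even. -/
def mpmd : Variant Unit where
  compat _ _ := True
  admissible l := Even l.length

/-- MBPMD: each request has a polarity in `{+1, -1}`, only requests of opposite polarity may be
paired, and there are as many positive as negative requests. -/
def mbpmd : Variant ℤˣ where
  compat b c := b * c = -1
  admissible l := l.count 1 = l.count (-1)

/-- A request at a point of `S`, with its label and its arrival time. -/
structure Request (S : Type u) (L : Type v) where
  point : S
  label : L
  time : ℝ

variable {S : Type u} {L : Type v} {V : Variant L}

/-- An input instance: a finite sequence of requests in order of arrival. -/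
structure Input (V : Variant L) (S : Type u) where
  requests : List (Request S L)
  sorted : requests.Pairwise fun a b => a.time ≤ b.time
  admissible : V.admissible (requests.map Request.label)

namespace Input

/-- The number of requests. -/
abbrev size (I : Input V S) : ℕ := I.requests.length

/-- The `i`-th request. -/
abbrev req (I : Input V S) (i : Fin I.size) : Request S L := I.requests.get i

/-- The requests revealed up to and including time `t`; as the requests are sorted by arrival
time, this is a prefix of the input. -/
def revealed (I : Input V S) (t : ℝ) : List (Request S L) :=
  I.requests.filter fun r => decide (r.time ≤ t)

end Input

/-- A solution of an instance: a perfect matching of its requests into compatible pairs. -/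
structure PerfectMatching (I : Input V S) where
  partner : Fin I.size → Fin I.size
  partner_partner : ∀ i, partner (partner i) = i
  partner_ne : ∀ i, partner i ≠ i
  compat : ∀ i, V.compat (I.req i).label (I.req (partner i)).label

namespace PerfectMatching

variable {I : Input V S}

/-- The total distance over all pairs; each pair `{i, partner i}` is counted once, at its
smaller index. -/
def connectionCost [PseudoMetricSpace S] (M : PerfectMatching I) : ℝ :=
  ∑ i with i < M.partner i, dist (I.req i).point (I.req (M.partner i)).point

/-- The offline delay cost: the sum of `|t_i - t_j|` over all pairs `{i, j}`. -/
def delayCost (M : PerfectMatching I) : ℝ :=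
  ∑ i with i < M.partner i, |(I.req i).time - (I.req (M.partner i)).time|

/-- The offline cost of a solution. -/
def cost [PseudoMetricSpace S] (M : PerfectMatching I) : ℝ :=
  M.connectionCost + M.delayCost

end PerfectMatching

/-- A perfect matching together with the time at which each pair is output; a pair is output
only after both of its requests have arrived. -/
structure TimedMatching (I : Input V S) extends PerfectMatching I where
  outTime : Fin I.size → ℝ
  outTime_partner : ∀ i, outTime (partner i) = outTime i
  arrival_le : ∀ i, (I.req i).time ≤ outTime i

namespace TimedMatching

variable {I : Input V S}

/-- The delay cost paid online: `(t - t_i) + (t - t_j)` for each pair `{i, j}` output at `t`. -/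
def waitingCost (M : TimedMatching I) : ℝ :=
  ∑ i with i < M.partner i,
    ((M.outTime i - (I.req i).time) + (M.outTime i - (I.req (M.partner i)).time))

/-- The total cost paid online. -/
def onlineCost [PseudoMetricSpace S] (M : TimedMatching I) : ℝ :=
  M.connectionCost + M.waitingCost

/-- Everything that has been output up to and including time `t`: the triples `(i, j, s)` such
that requests `i` and `j` were paired at time `s ≤ t`. -/
def outputUpTo (M : TimedMatching I) (t : ℝ) : Set (ℕ × ℕ × ℝ) :=
  {x | ∃ i : Fin I.size, M.outTime i ≤ t ∧ x = ((i : ℕ), (M.partner i : ℕ), M.outTime i)}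

end TimedMatching

/-- A deterministic online algorithm: on every instance it outputs a perfect matching in real
time, and what it has output up to time `t` depends only on the requests revealed up to
time `t`. -/
structure OnlineAlgorithm (V : Variant L) (S : Type u) where
  run : ∀ I : Input V S, TimedMatching I
  causal : ∀ (I J : Input V S) (t : ℝ), I.revealed t = J.revealed t →
    (run I).outputUpTo t = (run J).outputUpTo t

/-- A randomized online algorithm: a random choice of a deterministic online algorithm, such that
the output on each fixed instance is a random variable. -/
structure RandomizedAlgorithm (V : Variant L) (S : Type u) where
  Ω : Type
  [measurableSpace : MeasurableSpace Ω]
  P : Measure Ω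
  [isProbabilityMeasure : IsProbabilityMeasure P]
  alg : Ω → OnlineAlgorithm V S
  measurableSet_partner : ∀ (I : Input V S) (i j : Fin I.size),
    MeasurableSet {ω | ((alg ω).run I).partner i = j}
  measurable_outTime : ∀ (I : Input V S) (i : Fin I.size),
    Measurable fun ω => ((alg ω).run I).outTime i

attribute [instance] RandomizedAlgorithm.measurableSpace
attribute [instance] RandomizedAlgorithm.isProbabilityMeasure

namespace RandomizedAlgorithm

/-- The random cost of the algorithm on a fixed instance (chosen by an oblivious adversary). -/
def randomCost [PseudoMetricSpace S] (A : RandomizedAlgorithm V S) (I : Input V S) (ω : A.Ω) : ℝ :=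
  ((A.alg ω).run I).onlineCost

/-- `α`-competitiveness: on every instance, the expected cost exists and is at most `α` times the
cost of every solution of the instance. -/
def IsCompetitive [PseudoMetricSpace S] (A : RandomizedAlgorithm V S) (α : ℝ) : Prop :=
  ∀ I : Input V S, Integrable (A.randomCost I) A.P ∧
    ∀ M : PerfectMatching I, ∫ ω, A.randomCost I ω ∂A.P ≤ α * M.cost

end RandomizedAlgorithm

end MatchingWithDelays

end

/-! Randomness enters only through the choice of a tree. A finite metric space embeds, with expected
distortion `O(log n)`, into a random tree that dominates its metric and has height at most `log₂ n`.
On a tree of height `H`, a deterministic online algorithm pays at most `5` times the tree connection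
cost plus `5 * H + 1` times the delay cost of any solution (`onlineCost_treeAlgorithm_le`).
Averaging over the trees makes both factors `O(log n)`; the aspect ratio affects only the size of
the probability space and the number of radii.

The tree is a laminar family of weighted clusters. Each cluster has one counter per label, of
capacity twice the weight, which grows at the rate of the imbalance of the pending requests inside:
their parity for MPMD, their net polarity in the direction of the label for MBPMD. A pair is matched
as soon as all counters on its tree path are full, and these are reset. Three facts bound the cost.
(1) The counters reset by a match pay for its tree distance (`treeDist_add_totalCounter_le`). (2) If
nothing can be matched, the number of pending requests is at most twice the total growth rate plus
the overall imbalance, so growth pays for waiting (`card_pending_le`). This is combinatorics of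
laminar families: `Laminar.card_le_odd` for parities, `Laminar.sum_le_of_separated` for polarities.
(3) Growth is bounded by a potential that compares, in each cluster, the online and the offline
pending requests (`sum_rate_add_potential_advance_le`). Either the online side has an excess over
the offline one and growth lowers the potential, or the rate is at most the offline imbalance; an
offline pending request lies in at most `H` clusters. `Run.cost_le` adds these up along a run.

The trees are those of Fakcharoenphol, Rao and Talwar: the centre of a point at a given radius is
the first point, in a random order, within that radius. Their height depends on the aspect ratio, so
only light clusters are kept, those with at most half of the points of their parent. This bounds the
depth by `log₂ n`. Domination survives because two disjoint clusters with the same parent cannot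
both be heavy (`dist_le_treeDist_lightHierarchy`). -/

noncomputable section

namespace MatchingWithDelays

universe u

open scoped Classical

/-! ### Counting with laminar families -/

section

section Liveness

variable {α ι : Type*}

/-- Any two sets of the family are nested or disjoint. -/
def Laminar (A : ι → Set α) : Prop :=
  ∀ i j, A i ⊆ A j ∨ A j ⊆ A i ∨ Disjoint (A i) (A j)

theorem Laminar.preimage {β : Type*} {A : ι → Set α} (h : Laminar A) (f : β → α) :
    Laminar fun i => f ⁻¹' A i := by
  intro i j
  rcases h i j with h | h | h
  · exact Or.inl (Set.preimage_mono h)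
  · exact Or.inr (Or.inl (Set.preimage_mono h))
  · exact Or.inr (Or.inr (h.preimage f))

/-- In a nonempty finite part of a laminar family, some set has a trace on `P` which no set of
the family separates. -/
theorem Laminar.exists_minimal {A : ι → Set α} (h : Laminar A) (P : Finset α) (U : Finset ι)
    (hU : U.Nonempty) :
    ∃ u ∈ U, ∀ v ∈ U, ∀ a ∈ P, ∀ b ∈ P, a ∈ A u → b ∈ A u → a ∈ A v → b ∈ A v := by
  -- A set with the fewest elements of `P`: any set of `U` nested inside it has the same trace on
  -- `P`.
  obtain ⟨u, hu, hmin⟩ := U.exists_min_image (fun u => (P.filter (· ∈ A u)).card) hU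
  refine ⟨u, hu, fun v hv a ha b hb hau hbu hav => ?_⟩
  rcases h u v with huv | hvu | hd
  · exact huv hbu
  · have hsub : P.filter (· ∈ A v) ⊆ P.filter (· ∈ A u) := by
      intro x hx
      rw [Finset.mem_filter] at hx ⊢
      exact ⟨hx.1, hvu hx.2⟩
    have heq := Finset.eq_of_subset_of_card_le hsub (hmin v hv)
    have : b ∈ P.filter (· ∈ A v) := by
      rw [heq]; exact Finset.mem_filter.2 ⟨hb, hbu⟩
    exact (Finset.mem_filter.1 this).2
  · exact absurd hav (Set.disjoint_left.1 hd hau)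

/-- If every two elements of `P` are separated by a set of a laminar family, then the sets that
meet `P` in an odd number of elements are at least half as many as the elements of `P`. -/
theorem Laminar.card_le_odd {A : ι → Set α} (h : Laminar A) (U : Finset ι) :
    ∀ P : Finset α, (∀ a ∈ P, ∀ b ∈ P, a ≠ b → ∃ u ∈ U, ¬ (a ∈ A u ↔ b ∈ A u)) →
      P.card ≤ 2 * ∑ u ∈ U, (P.filter (· ∈ A u)).card % 2 + P.card % 2 := by
  induction U using Finset.strongInduction with
  | H U ih =>
    intro P hP
    rcases U.eq_empty_or_nonempty with rfl | hne
    · have : P.card ≤ 1 := by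
        rw [Finset.card_le_one]
        intro a ha b hb
        by_contra hab
        obtain ⟨u, hu, -⟩ := hP a ha b hb hab
        simp at hu
      interval_cases P.card <;> simp
    obtain ⟨u, hu, hmin⟩ := h.exists_minimal P U hne
    have hss := Finset.erase_ssubset hu
    rw [← Finset.add_sum_erase U _ hu]
    by_cases hsep : ∀ a ∈ P, ∀ b ∈ P, a ≠ b → ∃ v ∈ U.erase u, ¬ (a ∈ A v ↔ b ∈ A v)
    · have := ih _ hss P hsep
      omega
    push Not at hsep
    obtain ⟨a₀, ha₀, b₀, hb₀, hab₀, hns₀⟩ := hsep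
    obtain ⟨a, ha, b, hb, hab, hau, hbu, hns⟩ : ∃ a ∈ P, ∃ b ∈ P, a ≠ b ∧ a ∈ A u ∧ b ∉ A u ∧
        ∀ v ∈ U.erase u, (a ∈ A v ↔ b ∈ A v) := by
      obtain ⟨v, hv, hsv⟩ := hP a₀ ha₀ b₀ hb₀ hab₀
      have hvu : v = u := by
        by_contra hne
        exact hsv (hns₀ v (Finset.mem_erase.2 ⟨hne, hv⟩))
      subst hvu
      by_cases h1 : a₀ ∈ A v
      · exact ⟨a₀, ha₀, b₀, hb₀, hab₀, h1, fun h2 => hsv (by simp [h1, h2]), hns₀⟩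
      · refine ⟨b₀, hb₀, a₀, ha₀, hab₀.symm, ?_, h1, fun w hw => (hns₀ w hw).symm⟩
        by_contra h2
        exact hsv (by simp [h1, h2])
    have honly : ∀ x ∈ P, x ∈ A u → x = a := by
      intro x hx hxu
      by_contra hxa
      obtain ⟨v, hv, hsv⟩ := hP x hx a ha hxa
      exact hsv ⟨hmin v hv x hx a ha hxu hau, hmin v hv a ha x hx hau hxu⟩
    have hfu : P.filter (· ∈ A u) = {a} := by
      ext x
      simp only [Finset.mem_filter, Finset.mem_singleton]
      exact ⟨fun hx => honly x hx.1 hx.2, fun hx => hx ▸ ⟨ha, hau⟩⟩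
    rw [hfu, Finset.card_singleton]
    -- Every other set contains both or neither of `a` and `b`, so removing both keeps the other
    -- parities. The odd set `A u` pays for two elements, whence the factor `2`.
    set P' := (P.erase a).erase b with hP'
    have hba : b ∈ P.erase a := Finset.mem_erase.2 ⟨hab.symm, hb⟩
    have hcard : P'.card + 2 = P.card := by
      have h1 := Finset.card_erase_add_one ha
      have h2 := Finset.card_erase_add_one hba
      rw [← hP'] at h2
      omega
    have hmem : ∀ x, x ∈ P' ↔ x ≠ b ∧ x ≠ a ∧ x ∈ P := by
      intro x; simp [hP']
    have hI := ih _ hss P' (by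
      intro x hx y hy hxy
      obtain ⟨hxb, hxa, hx⟩ := (hmem x).1 hx
      obtain ⟨hyb, hya, hy⟩ := (hmem y).1 hy
      obtain ⟨v, hv, hsv⟩ := hP x hx y hy hxy
      refine ⟨v, Finset.mem_erase.2 ⟨?_, hv⟩, hsv⟩
      rintro rfl
      exact hsv ⟨fun h => absurd (honly x hx h) hxa, fun h => absurd (honly y hy h) hya⟩)
    have hpar : ∀ v ∈ U.erase u, (P.filter (· ∈ A v)).card % 2 = (P'.filter (· ∈ A v)).card % 2 := by
      intro v hv
      have hPP : P = insert a (insert b P') := by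
        rw [hP', Finset.insert_erase hba, Finset.insert_erase ha]
      have hb' : b ∉ P' := by simp [hP']
      have ha' : a ∉ insert b P' := by simp [hP', hab]
      rw [hPP, Finset.filter_insert, Finset.filter_insert]
      by_cases hav : a ∈ A v
      · have hbv := (hns v hv).1 hav
        rw [if_pos hav, if_pos hbv, Finset.card_insert_of_notMem, Finset.card_insert_of_notMem]
        · omega
        · simp [hb']
        · simpa [hab] using fun h => absurd h (by simp [hP'])
      · have hbv : b ∉ A v := fun hbv => hav ((hns v hv).2 hbv)
        rw [if_neg hav, if_neg hbv]
    rw [Finset.sum_congr rfl hpar]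
    omega

/-- A bound on the total charge of a set `X` that is closed in the sense that every pair in
`X × Xᶜ` is separated by a set of a laminar family in an admissible direction. -/
theorem Laminar.sum_le_of_separated {A : ι → Set α} (h : Laminar A) (P : Finset α) (c : α → ℤ)
    (p n : ι → Prop) (U : Finset ι) :
    ∀ X ⊆ P, (∀ x ∈ X, ∀ y ∈ P, y ∉ X →
        ∃ u ∈ U, (x ∈ A u ∧ y ∉ A u ∧ p u) ∨ (y ∈ A u ∧ x ∉ A u ∧ n u)) →
      ∑ x ∈ X, c x ≤ ∑ u ∈ U, ((if p u then max (∑ a ∈ P with a ∈ A u, c a) 0 else 0) +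
        (if n u then max (-∑ a ∈ P with a ∈ A u, c a) 0 else 0)) + max (∑ a ∈ P, c a) 0 := by
  induction U using Finset.strongInduction with
  | H U ih =>
    intro X hX hsep
    rcases U.eq_empty_or_nonempty with rfl | hne
    · rcases X.eq_empty_or_nonempty with rfl | ⟨x, hx⟩
      · simp
      · have : X = P := by
          refine Finset.Subset.antisymm hX fun y hy => ?_
          by_contra hyX
          obtain ⟨u, hu, -⟩ := hsep x hx y hy hyX
          simp at hu
        subst this
        simp
    obtain ⟨u, hu, hmin⟩ := h.exists_minimal P U hne
    have hss := Finset.erase_ssubset hu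
    rw [← Finset.add_sum_erase U _ hu]
    set s := ∑ a ∈ P with a ∈ A u, c a with hs
    by_cases hsep' : ∀ x ∈ X, ∀ y ∈ P, y ∉ X →
        ∃ v ∈ U.erase u, (x ∈ A v ∧ y ∉ A v ∧ p v) ∨ (y ∈ A v ∧ x ∉ A v ∧ n v)
    · have := ih _ hss X hX hsep'
      have h1 : 0 ≤ (if p u then max s 0 else 0) := by split_ifs <;> simp
      have h2 : 0 ≤ (if n u then max (-s) 0 else 0) := by split_ifs <;> simp
      linarith
    push Not at hsep'
    obtain ⟨x, hx, y, hy, hyX, hns⟩ := hsep'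
    have hbridge : ∀ x' ∈ P, ∀ y' ∈ P, x' ∈ X → y' ∉ X → x' ∉ A u → y' ∉ A u →
        ∃ v ∈ U.erase u, (x' ∈ A v ∧ y' ∉ A v ∧ p v) ∨ (y' ∈ A v ∧ x' ∉ A v ∧ n v) := by
      intro x' _ y' hy' hxX' hyX' hxu hyu
      obtain ⟨v, hv, hvs⟩ := hsep x' hxX' y' hy' hyX'
      refine ⟨v, Finset.mem_erase.2 ⟨?_, hv⟩, hvs⟩
      rintro rfl
      rcases hvs with hvs | hvs
      · exact hxu hvs.1
      · exact hyu hvs.1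
    have hxP := hX hx
    obtain ⟨w, hw, hws⟩ := hsep x hx y hy hyX
    have hwu : w = u := by
      by_contra hne
      obtain ⟨h1, h2⟩ := hns w (Finset.mem_erase.2 ⟨hne, hw⟩)
      rcases hws with hws | hws
      · exact h1 hws.1 hws.2.1 hws.2.2
      · exact h2 hws.1 hws.2.1 hws.2.2
    subst hwu
    -- The trace of `A w` lies entirely inside or entirely outside `X`, so it can be moved across as
    -- a block, and its charge `s` is paid for by `w`.
    have hunsep : ∀ a ∈ P, ∀ b ∈ P, a ∈ A w → b ∈ A w → a ∈ X → b ∈ X := by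
      intro a ha b hb haw hbw haX
      by_contra hbX
      obtain ⟨v, hv, hvs⟩ := hsep a haX b hb hbX
      rcases hvs with hvs | hvs
      · exact hvs.2.1 (hmin v hv a ha b hb haw hbw hvs.1)
      · exact hvs.2.1 (hmin v hv b hb a ha hbw haw hvs.1)
    -- A trace inside `X` is taken out, a trace outside is put in. Since only `w` separates `x` from
    -- `y` admissibly, points of the moved trace inherit their separations from those of the partner
    -- outside `A w`, and `w` is no longer needed.
    rcases hws with ⟨hxw, hyw, hpw⟩ | ⟨hyw, hxw, hnw⟩
    · have hsub : P.filter (· ∈ A w) ⊆ X := by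
        intro a ha
        rw [Finset.mem_filter] at ha
        exact hunsep x hxP a ha.1 hxw ha.2 hx
      have hI := ih _ hss (X \ P.filter (· ∈ A w)) (Finset.sdiff_subset.trans hX) (by
        intro x' hx' y' hy' hyX'
        simp only [Finset.mem_sdiff, Finset.mem_filter, not_and] at hx' hyX'
        have hxP' := hX hx'.1
        have hxw' := hx'.2 hxP'
        by_cases hyX'' : y' ∈ X
        · have hyw' : y' ∈ A w := by_contra fun hc => hyX' hyX'' fun _ => hc
          obtain ⟨v, hv, hvs⟩ := hbridge x' hxP' y hy hx'.1 hyX hxw' hyw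
          have hvU := Finset.mem_of_mem_erase hv
          obtain ⟨h1, h2⟩ := hns v hv
          refine ⟨v, hv, ?_⟩
          rcases hvs with hvs | hvs
          · refine Or.inl ⟨hvs.1, fun hyv => ?_, hvs.2.2⟩
            exact h1 (hmin v hvU y' hy' x hxP hyw' hxw hyv) hvs.2.1 hvs.2.2
          · have hxv : x ∈ A v := by
              by_contra hxv
              exact h2 hvs.1 hxv hvs.2.2
            exact Or.inr ⟨hmin v hvU x hxP y' hy' hxw hyw' hxv, hvs.2.1, hvs.2.2⟩
        · refine hbridge x' hxP' y' hy' hx'.1 hyX'' hxw' fun hyw' => ?_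
          exact hyX'' (hunsep x hxP y' hy' hxw hyw' hx))
      have hsum := Finset.sum_sdiff (f := c) hsub
      rw [if_pos hpw]
      have h2 : 0 ≤ (if n w then max (-s) 0 else 0) := by split_ifs <;> simp
      have h3 := le_max_left s 0
      linarith
    · have hdis : Disjoint X (P.filter (· ∈ A w)) := by
        rw [Finset.disjoint_left]
        intro a haX ha
        rw [Finset.mem_filter] at ha
        exact hyX (hunsep a ha.1 y hy ha.2 hyw haX)
      have hI := ih _ hss (X ∪ P.filter (· ∈ A w))
        (Finset.union_subset hX (Finset.filter_subset _ _)) (by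
        intro x' hx' y' hy' hyX'
        simp only [Finset.mem_union, Finset.mem_filter, not_or, not_and] at hx' hyX'
        have hyw' := hyX'.2 hy'
        rcases hx' with hx' | ⟨hxP', hxw'⟩
        · refine hbridge x' (hX hx') y' hy' hx' hyX'.1 (fun hxw' => ?_) hyw'
          exact hyX (hunsep x' (hX hx') y hy hxw' hyw hx')
        · obtain ⟨v, hv, hvs⟩ := hbridge x hxP y' hy' hx hyX'.1 hxw hyw'
          have hvU := Finset.mem_of_mem_erase hv
          obtain ⟨h1, h2⟩ := hns v hv
          refine ⟨v, hv, ?_⟩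
          rcases hvs with hvs | hvs
          · have hyv : y ∈ A v := by
              by_contra hyv
              exact h1 hvs.1 hyv hvs.2.2
            exact Or.inl ⟨hmin v hvU y hy x' hxP' hyw hxw' hyv, hvs.2.1, hvs.2.2⟩
          · refine Or.inr ⟨hvs.1, fun hxv => ?_, hvs.2.2⟩
            exact h2 (hmin v hvU x' hxP' y hy hxw' hyw hxv) hvs.2.1 hvs.2.2)
      rw [Finset.sum_union hdis] at hI
      rw [if_pos hnw]
      have h2 : 0 ≤ (if p w then max s 0 else 0) := by split_ifs <;> simp
      have h3 := le_max_left (-s) 0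
      linarith

end Liveness

end

/-! ### Charges and excesses, for parity and for polarity -/

section

/-- The potential of a counter of capacity `cap` with value `z`, where `n` is the excess of the
difference between the online and the offline set of pending requests. -/
def counterPotential (cap : ℝ) (n : ℕ) (z : ℝ) : ℝ :=
  if n = 0 then z else cap * n - z

/-- Charges for the requests such that compatible requests are those of opposite charge, with a
measure `excess l y` of how much of the charge `y` has to be resolved by requests labelled `l`
leaving.  A common framework for the two variants of the matching problem. -/
structure ChargeSystem {L : Type} [Fintype L] (V : Variant L) (G : Type) [AddCommGroup G] where
  charge : L → G
  excess : L → G → ℕ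
  compat_iff : ∀ a b, V.compat a b ↔ charge a + charge b = 0
  sum_charge : ∀ l, V.admissible l → (l.map charge).sum = 0
  excess_zero : ∀ l, excess l 0 = 0
  -- For online surplus `x` and offline surplus `y`: without an excess of the difference, a counter
  -- grows no faster than the offline excess.
  excess_le : ∀ l x y, excess l (x - y) = 0 → excess l x ≤ excess l y
  sum_excess_add_le : ∀ l y, ∑ k, excess k (y + charge l) ≤ ∑ k, excess k y + 1
  -- Completing an offline pair shifts the difference by one charge in each cluster that separates
  -- the pair, at the price of one capacity.
  potential_add_le : ∀ (l : L) (y : G) (cap : ℝ) (z : L → ℝ), (∀ k, 0 ≤ z k) → (∀ k, z k ≤ cap) →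
    ∑ k, counterPotential cap (excess k (y + charge l)) (z k) ≤
      ∑ k, counterPotential cap (excess k y) (z k) + cap
  -- An online match takes one charge out of each separating cluster; resetting the full counter
  -- compensates for it.
  potential_sub_le : ∀ (l : L) (y : G) (cap : ℝ) (z : L → ℝ), (∀ k, 0 ≤ z k) → (∀ k, z k ≤ cap) →
    z l = cap →
    ∑ k, counterPotential cap (excess k (y - charge l)) (if k = l then 0 else z k) ≤
      ∑ k, counterPotential cap (excess k y) (z k)
  -- `U i l` stands for a counter that is not full. The hypothesis then says that every compatible
  -- pair is blocked by such a counter on its path.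
  card_le : ∀ {α ι : Type u} [Fintype ι] (A : ι → Set α), Laminar A → ∀ (U : ι → L → Prop)
    (lab : α → L) (P : Finset α),
    (∀ a ∈ P, ∀ b ∈ P, a ≠ b → V.compat (lab a) (lab b) →
      ∃ i, (a ∈ A i ∧ b ∉ A i ∧ U i (lab a)) ∨ (b ∈ A i ∧ a ∉ A i ∧ U i (lab b))) →
    P.card ≤ 2 * ∑ i, ∑ l, (if U i l then excess l (∑ a ∈ P with a ∈ A i, charge (lab a)) else 0) +
      ∑ l, excess l (∑ a ∈ P, charge (lab a))

theorem counterPotential_nonneg {cap z : ℝ} (n : ℕ) (hz : 0 ≤ z) (hc : z ≤ cap) :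
    0 ≤ counterPotential cap n z := by
  unfold counterPotential
  split_ifs with h
  · exact hz
  · have : (1 : ℝ) ≤ n := by exact_mod_cast Nat.one_le_iff_ne_zero.2 h
    nlinarith

theorem counterPotential_toNat (cap z : ℝ) (y : ℤ) :
    counterPotential cap y.toNat z = if y ≤ 0 then z else cap * y - z := by
  unfold counterPotential
  by_cases h : y ≤ 0
  · rw [if_pos h, if_pos (Int.toNat_eq_zero.2 h)]
  · rw [if_neg h, if_neg fun h' => h (Int.toNat_eq_zero.1 h')]
    congr 2
    exact_mod_cast Int.toNat_of_nonneg (le_of_not_ge h)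

/-- Parity of the number of requests as a charge system for MPMD. -/
def parityCharges : ChargeSystem.{u} mpmd (ZMod 2) where
  charge _ := 1
  excess _ y := y.val
  compat_iff _ _ := by
    simp only [mpmd, true_iff]; rfl
  sum_charge l h := by
    have h : Even l.length := h
    rw [List.map_const', List.sum_replicate, nsmul_eq_mul, mul_one]
    exact (ZMod.natCast_eq_zero_iff_even).2 h
  excess_zero _ := rfl
  excess_le _ x y h := by
    have : x - y = 0 := (ZMod.val_eq_zero _).1 h
    rw [sub_eq_zero.1 this]
  sum_excess_add_le _ y := by
    fin_cases y <;> simp <;> decide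
  potential_add_le _ y cap z h0 hc := by
    have h1 := h0 ()
    have h2 := hc ()
    have e : ((1 : ZMod 2) + 1) = 0 := rfl
    have v : (1 : ZMod 2).val = 1 := rfl
    obtain rfl | rfl : y = 0 ∨ y = 1 := by revert y; decide
    · simp [counterPotential, v]; linarith
    · simp [counterPotential, e, v]; linarith
  potential_sub_le l y cap z h0 hc hl := by
    have hl : z () = cap := hl
    have h1 := h0 ()
    have e : ((0 : ZMod 2) - 1) = 1 := rfl
    have v : (1 : ZMod 2).val = 1 := rfl
    obtain rfl | rfl : y = 0 ∨ y = 1 := by revert y; decide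
    · simp [counterPotential, v, hl, e]
    · simp [counterPotential, v, hl]
  card_le := by
    intro α ι _ A hA U lab P hP
    have hval : ∀ Q : Finset α, (∑ a ∈ Q, (1 : ZMod 2)).val = Q.card % 2 := by
      intro Q
      rw [Finset.sum_const, nsmul_eq_mul, mul_one, ZMod.val_natCast]
    have := hA.card_le_odd (Finset.univ.filter fun i => U i ()) P (by
      intro a ha b hb hab
      obtain ⟨i, hi⟩ := hP a ha b hb hab trivial
      rcases hi with ⟨h1, h2, h3⟩ | ⟨h1, h2, h3⟩
      · exact ⟨i, by simpa using h3, by simp [h1, h2]⟩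
      · exact ⟨i, by simpa using h3, by simp [h1, h2]⟩)
    rw [Finset.sum_filter] at this
    simpa [hval] using this

/-- The polarity as a charge system for MBPMD. -/
def polarityCharges : ChargeSystem.{u} mbpmd ℤ where
  charge l := l
  excess l y := (l * y).toNat
  compat_iff a b := by
    rcases Int.units_eq_one_or a with rfl | rfl <;> rcases Int.units_eq_one_or b with rfl | rfl <;>
      simp [mbpmd]
  sum_charge l h := by
    have key : ∀ l : List ℤˣ, (l.map fun l : ℤˣ => (l : ℤ)).sum = l.count 1 - l.count (-1) := by
      intro l
      induction l with
      | nil => simp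
      | cons a l ih =>
        rcases Int.units_eq_one_or a with rfl | rfl
        · have : (1 : ℤˣ) ≠ -1 := by decide
          simp [ih]
          ring
        · have : (-1 : ℤˣ) ≠ 1 := by decide
          simp [ih, this]
          ring
    have h : l.count 1 = l.count (-1) := h
    rw [key, h, sub_self]
  excess_zero _ := by simp
  excess_le l x y h := by
    rcases Int.units_eq_one_or l with rfl | rfl <;> simp at h ⊢ <;> omega
  sum_excess_add_le l y := by
    rw [UnitsInt.univ]
    rcases Int.units_eq_one_or l with rfl | rfl <;> simp <;> omega
  potential_add_le l y cap z h0 hc := by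
    have hne : (1 : ℤˣ) ≠ -1 := by decide
    have h1 := h0 1
    have h2 := h0 (-1)
    have h3 := hc 1
    have h4 := hc (-1)
    rw [UnitsInt.univ, Finset.sum_pair hne, Finset.sum_pair hne]
    simp only [counterPotential_toNat]
    rcases Int.units_eq_one_or l with rfl | rfl <;> push_cast <;> split_ifs <;>
      first
        | omega
        | nlinarith
        | (obtain rfl | rfl | rfl : y = -1 ∨ y = 0 ∨ y = 1 := by omega) <;>
            first
              | omega
              | (push_cast; linarith)
  potential_sub_le l y cap z h0 hc hl := by
    have hne : (1 : ℤˣ) ≠ -1 := by decide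
    have h1 := h0 1
    have h2 := h0 (-1)
    have h3 := hc 1
    have h4 := hc (-1)
    rw [UnitsInt.univ, Finset.sum_pair hne, Finset.sum_pair hne]
    simp only [counterPotential_toNat]
    rcases Int.units_eq_one_or l with rfl | rfl <;> simp only [hne, hne.symm, if_true, if_false] <;> push_cast <;> split_ifs <;>
      first
        | omega
        | nlinarith
        | (obtain rfl | rfl | rfl : y = -1 ∨ y = 0 ∨ y = 1 := by omega) <;>
            first
              | omega
              | (push_cast; linarith)
  card_le := by
    intro α ι _ A hA U lab P hP
    have hlab : ∀ a, lab a = 1 ∨ lab a = -1 := fun a => Int.units_eq_one_or _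
    have hne : (1 : ℤˣ) ≠ -1 := by decide
    -- `X` consists of the positive requests, so the pairs to be separated are exactly the
    -- compatible ones.
    have := hA.sum_le_of_separated P (fun a => (lab a : ℤ)) (fun i => U i 1) (fun i => U i (-1))
      Finset.univ (P.filter fun a => lab a = 1) (Finset.filter_subset _ _) (by
        intro x hx y hy hyX
        rw [Finset.mem_filter] at hx
        have hy1 : lab y = -1 := (hlab y).resolve_left fun h => hyX (Finset.mem_filter.2 ⟨hy, h⟩)
        obtain ⟨i, hi⟩ := hP x hx.1 y hy (by rintro rfl; exact hne (hx.2.symm.trans hy1))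
          (by rw [hx.2, hy1]; exact one_mul _)
        rw [hx.2, hy1] at hi
        exact ⟨i, Finset.mem_univ _, hi⟩)
    have hsplit := Finset.sum_filter_add_sum_filter_not P (fun a => lab a = 1)
      (fun a => (lab a : ℤ))
    have hcard := Finset.card_filter_add_card_filter_not (s := P) (fun a => lab a = 1)
    have hpos : ∑ a ∈ P with lab a = 1, (lab a : ℤ) = (P.filter fun a => lab a = 1).card := by
      rw [Finset.sum_congr rfl fun a ha => by rw [(Finset.mem_filter.1 ha).2]]
      simp
    have hneg : ∑ a ∈ P with ¬ lab a = 1, (lab a : ℤ) = -(P.filter fun a => ¬ lab a = 1).card := by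
      rw [Finset.sum_congr rfl fun a ha => by
        rw [(hlab a).resolve_left (Finset.mem_filter.1 ha).2]]
      simp
    have hterm : ((∑ i, ∑ l : ℤˣ, (if U i l then
        (l * ∑ a ∈ P with a ∈ A i, (lab a : ℤ)).toNat else 0) : ℕ) : ℤ) =
        ∑ i, ((if U i 1 then max (∑ a ∈ P with a ∈ A i, (lab a : ℤ)) 0 else 0) +
          (if U i (-1) then max (-∑ a ∈ P with a ∈ A i, (lab a : ℤ)) 0 else 0)) := by
      push_cast
      refine Finset.sum_congr rfl fun i _ => ?_
      rw [UnitsInt.univ, Finset.sum_pair hne]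
      simp
    rw [← hterm, hpos] at this
    rw [hpos, hneg] at hsplit
    rw [UnitsInt.univ, Finset.sum_pair hne]
    rw [UnitsInt.univ] at this
    push_cast
    rw [one_mul, neg_one_mul]
    -- With `k` positive requests and net polarity `s` there are `2k - s` requests; `k` is at most
    -- the double sum plus `s⁺`, and `2s⁺ - s = |s|`.
    omega

end

/-! ### The algorithm on a tree as a sequence of events -/

section

/-- A laminar family of weighted clusters of points, i.e. the edge-weighted tree whose vertices
are the clusters. -/
structure Hierarchy (S : Type u) where
  ι : Type u
  [fintype : Fintype ι]
  cluster : ι → Set S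
  weight : ι → ℝ
  weight_nonneg : ∀ i, 0 ≤ weight i
  laminar : Laminar cluster

attribute [instance] Hierarchy.fintype

/-- The tree distance of two points: the total weight of the clusters that separate them. -/
def Hierarchy.treeDist {S : Type u} (T : Hierarchy S) (p q : S) : ℝ :=
  ∑ i, if (p ∈ T.cluster i ↔ q ∈ T.cluster i) then 0 else T.weight i

/-- A request together with its position in the input. -/
abbrev IndexedRequest (S : Type u) (L : Type) := Request S L × ℕ

/-- A pair of requests together with the time at which it is output. -/
abbrev TimedPair (S : Type u) (L : Type) := (IndexedRequest S L × IndexedRequest S L) × ℝ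

variable {S : Type u} {L : Type} {V : Variant L} {G : Type} [AddCommGroup G]

/-- The state of the algorithm on a tree: the time, a counter for each cluster and each label, and
the requests that are still to be matched. -/
structure State (T : Hierarchy S) (L : Type) where
  clock : ℝ
  counter : T.ι → L → ℝ
  pending : Finset (IndexedRequest S L)

variable {T : Hierarchy S}

namespace State

/-- The counter has reached its capacity. -/
def Full (st : State T L) (u : T.ι) (l : L) : Prop := 2 * T.weight u ≤ st.counter u l

/-- The counter lies on the tree path between the two requests. -/
def OnPath (p : IndexedRequest S L × IndexedRequest S L) (u : T.ι) (l : L) : Prop :=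
  (p.1.1.point ∈ T.cluster u ∧ p.2.1.point ∉ T.cluster u ∧ l = p.1.1.label) ∨
    (p.2.1.point ∈ T.cluster u ∧ p.1.1.point ∉ T.cluster u ∧ l = p.2.1.label)

/-- Two pending requests that may be matched because all counters on their path are full. -/
def Matchable (V : Variant L) (st : State T L) (p : IndexedRequest S L × IndexedRequest S L) :
    Prop :=
  p.1 ∈ st.pending ∧ p.2 ∈ st.pending ∧ p.1 ≠ p.2 ∧ V.compat p.1.1.label p.2.1.label ∧
    ∀ u l, OnPath p u l → st.Full u l

/-- A choice of a matchable pair. -/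
def pick (V : Variant L) (st : State T L) :
    Option (IndexedRequest S L × IndexedRequest S L) :=
  if h : ∃ p, st.Matchable V p then some h.choose else none

theorem matchable_of_pick {st : State T L} {p} (h : st.pick V = some p) : st.Matchable V p := by
  unfold pick at h
  split_ifs at h with h'
  rw [← Option.some.inj h]
  exact h'.choose_spec

theorem not_matchable_of_pick {st : State T L} (h : st.pick V = none) (p) :
    ¬ st.Matchable V p := by
  unfold pick at h
  split_ifs at h with h'
  exact fun hp => h' ⟨p, hp⟩

/-- Matching a pair removes it from the pending requests and resets the counters on its path. -/
def pair (st : State T L) (p : IndexedRequest S L × IndexedRequest S L) : State T L where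
  clock := st.clock
  counter u l := if OnPath p u l then 0 else st.counter u l
  pending := (st.pending.erase p.1).erase p.2

theorem sum_pair {M : Type*} [AddCommMonoid M] {st : State T L} {p}
    (hp : st.Matchable V p) (f : IndexedRequest S L → M) :
    ∑ a ∈ st.pending, f a = f p.1 + (f p.2 + ∑ a ∈ (st.pair p).pending, f a) := by
  have h2 : p.2 ∈ st.pending.erase p.1 := Finset.mem_erase.2 ⟨hp.2.2.1.symm, hp.2.1⟩
  rw [pair, Finset.add_sum_erase _ _ h2, Finset.add_sum_erase _ _ hp.1]

/-- The arrival of a request. -/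
def arrive (st : State T L) (r : IndexedRequest S L) : State T L where
  clock := st.clock
  counter := st.counter
  pending := insert r st.pending

end State

variable [Fintype L]

/-- The total charge of the requests at the points of `A`. -/
def ChargeSystem.surplus (Ch : ChargeSystem.{u} V G) (P : Finset (IndexedRequest S L))
    (A : Set S) : G :=
  ∑ a ∈ P with a.1.point ∈ A, Ch.charge a.1.label

variable (Ch : ChargeSystem.{u} V G)

namespace State

/-- The rate at which a counter grows. -/
def rate (st : State T L) (u : T.ι) (l : L) : ℕ :=
  if st.Full u l then 0 else Ch.excess l (Ch.surplus st.pending (T.cluster u))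

/-- The passage of time. -/
def advance (st : State T L) (d : ℝ) : State T L where
  clock := st.clock + d
  counter u l := st.counter u l + d * st.rate Ch u l
  pending := st.pending

/-- No counter exceeds its capacity within time `d`. -/
def Admits (st : State T L) (d : ℝ) : Prop :=
  0 ≤ d ∧ ∀ u l, st.counter u l + d * st.rate Ch u l ≤ 2 * T.weight u

/-- Some growing counter reaches its capacity at time `d` from now. -/
def Saturates (st : State T L) (d : ℝ) : Prop :=
  ∃ u l, 0 < st.rate Ch u l ∧ st.counter u l + d * st.rate Ch u l = 2 * T.weight u

/-- The invariants of a state, given the requests yet to arrive. -/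
structure Consistent (st : State T L) (fut : List (IndexedRequest S L)) : Prop where
  counter_nonneg : ∀ u l, 0 ≤ st.counter u l
  counter_le : ∀ u l, st.counter u l ≤ 2 * T.weight u
  sorted : fut.Pairwise fun a b => a.1.time ≤ b.1.time
  clock_le : ∀ r ∈ fut, st.clock ≤ r.1.time
  le_clock : ∀ r ∈ st.pending, r.1.time ≤ st.clock
  nodup : fut.Nodup
  fresh : ∀ r ∈ fut, r ∉ st.pending
  charge_eq : ∑ a ∈ st.pending, Ch.charge a.1.label +
    (fut.map fun r => Ch.charge r.1.label).sum = 0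

variable {Ch}

theorem Consistent.pair {st : State T L} {fut} (h : st.Consistent Ch fut) {p}
    (hp : st.Matchable V p) : (st.pair p).Consistent Ch fut where
  counter_nonneg u l := by
    unfold State.pair
    dsimp only
    split_ifs
    exacts [le_rfl, h.counter_nonneg u l]
  counter_le u l := by
    unfold State.pair
    dsimp only
    split_ifs
    exacts [mul_nonneg zero_le_two (T.weight_nonneg u), h.counter_le u l]
  sorted := h.sorted
  clock_le := h.clock_le
  le_clock r hr := h.le_clock r (Finset.mem_of_mem_erase (Finset.mem_of_mem_erase hr))
  nodup := h.nodup
  fresh r hr hr' := h.fresh r hr (Finset.mem_of_mem_erase (Finset.mem_of_mem_erase hr'))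
  charge_eq := by
    have h1 := h.charge_eq
    rw [sum_pair hp, ← add_assoc (Ch.charge _), (Ch.compat_iff _ _).1 hp.2.2.2.1, zero_add] at h1
    exact h1

theorem Consistent.advance {st : State T L} {fut} (h : st.Consistent Ch fut) {d : ℝ}
    (hd : st.Admits Ch d) (hfut : ∀ r ∈ fut, st.clock + d ≤ r.1.time) :
    (st.advance Ch d).Consistent Ch fut where
  counter_nonneg u l := add_nonneg (h.counter_nonneg u l) (mul_nonneg hd.1 (Nat.cast_nonneg _))
  counter_le := hd.2
  sorted := h.sorted
  clock_le := hfut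
  le_clock r hr := (h.le_clock r hr).trans (le_add_of_nonneg_right hd.1)
  nodup := h.nodup
  fresh := h.fresh
  charge_eq := h.charge_eq

theorem Consistent.arrive {st : State T L} {r fut} (h : st.Consistent Ch (r :: fut))
    (hr : r.1.time ≤ st.clock) : (st.arrive r).Consistent Ch fut where
  counter_nonneg := h.counter_nonneg
  counter_le := h.counter_le
  sorted := (List.pairwise_cons.1 h.sorted).2
  clock_le r' hr' := h.clock_le r' (List.mem_cons_of_mem _ hr')
  le_clock r' hr' := by
    rcases Finset.mem_insert.1 hr' with rfl | hr'
    exacts [hr, h.le_clock r' hr']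
  nodup := (List.nodup_cons.1 h.nodup).2
  fresh r' hr' hmem := by
    rcases Finset.mem_insert.1 hmem with rfl | hmem
    · exact (List.nodup_cons.1 h.nodup).1 hr'
    · exact h.fresh r' (List.mem_cons_of_mem _ hr') hmem
  charge_eq := by
    have h1 := h.charge_eq
    have h2 := h.fresh r List.mem_cons_self
    rw [State.arrive, Finset.sum_insert h2]
    rw [List.map_cons, List.sum_cons] at h1
    rw [← h1]
    abel

theorem Consistent.advance_arrive {st : State T L} {r fut} (h : st.Consistent Ch (r :: fut))
    (hd : st.Admits Ch (r.1.time - st.clock)) :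
    ((st.advance Ch (r.1.time - st.clock)).arrive r).Consistent Ch fut := by
  refine Consistent.arrive (h.advance hd fun r' hr' => ?_) (by simp [State.advance])
  rw [add_sub_cancel]
  rcases List.mem_cons.1 hr' with rfl | hr'
  · exact le_rfl
  · exact (List.pairwise_cons.1 h.sorted).1 r' hr'

/-- If no pair can be matched, the number of pending requests is controlled by the total rate of
growth of the counters. -/
theorem card_pending_le {st : State T L} (h : st.pick V = none) :
    st.pending.card ≤ 2 * ∑ u, ∑ l, st.rate Ch u l +
      ∑ l, Ch.excess l (∑ a ∈ st.pending, Ch.charge a.1.label) := by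
  have := Ch.card_le (fun u => (fun a : IndexedRequest S L => a.1.point) ⁻¹' T.cluster u)
    (T.laminar.preimage _) (fun u l => ¬ st.Full u l) (fun a => a.1.label) st.pending (by
      intro a ha b hb hab hc
      have hn := not_matchable_of_pick h (a, b)
      have : ¬ ∀ u l, OnPath (a, b) u l → st.Full u l := fun h' => hn ⟨ha, hb, hab, hc, h'⟩
      push Not at this
      obtain ⟨u, l, hp, hf⟩ := this
      refine ⟨u, ?_⟩
      rcases hp with ⟨h1, h2, rfl⟩ | ⟨h1, h2, rfl⟩
      exacts [Or.inl ⟨h1, h2, hf⟩, Or.inr ⟨h1, h2, hf⟩])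
  simpa only [State.rate, ChargeSystem.surplus, ite_not, Set.mem_preimage] using this

theorem rate_eq_zero {st : State T L} (h : st.pending = ∅) (u l) : st.rate Ch u l = 0 := by
  simp [rate, ChargeSystem.surplus, h, Ch.excess_zero]

/-- If counters are growing, one of them is the first to reach its capacity. -/
theorem exists_saturates {st : State T L} {fut} (h : st.Consistent Ch fut)
    (hr : ∃ u l, 0 < st.rate Ch u l) : ∃ d, st.Admits Ch d ∧ st.Saturates Ch d := by
  obtain ⟨u₀, l₀, h₀⟩ := hr
  obtain ⟨x, hx, hmin⟩ := (Finset.univ.filter fun x : T.ι × L => 0 < st.rate Ch x.1 x.2)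
    |>.exists_min_image (fun x => (2 * T.weight x.1 - st.counter x.1 x.2) / st.rate Ch x.1 x.2)
      ⟨(u₀, l₀), by simpa using h₀⟩
  simp only [Finset.mem_filter, Finset.mem_univ, true_and] at hx hmin
  have hx' : (0 : ℝ) < st.rate Ch x.1 x.2 := by exact_mod_cast hx
  refine ⟨_, ⟨div_nonneg (sub_nonneg.2 (h.counter_le x.1 x.2)) hx'.le, fun u l => ?_⟩,
    x.1, x.2, hx, by field_simp; ring⟩
  rcases Nat.eq_zero_or_pos (st.rate Ch u l) with h0 | h0
  · rw [h0]
    simpa using h.counter_le u l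
  · have h1 := hmin (u, l) h0
    have h2 : (0 : ℝ) < st.rate Ch u l := by exact_mod_cast h0
    rw [le_div_iff₀ h2] at h1
    linarith

end State

open State

/-- `Run Ch st fut outs` means that the algorithm, when started in state `st` with the requests
`fut` yet to arrive, outputs `outs`. -/
inductive Run : State T L → List (IndexedRequest S L) → List (TimedPair S L) → Prop
  | done (st) : st.pending = ∅ → Run st [] []
  | pair (st p fut outs) : st.pick V = some p → Run (st.pair p) fut outs →
      Run st fut ((p, st.clock) :: outs)
  | arrive (st r fut outs) : st.pick V = none → st.Admits Ch (r.1.time - st.clock) →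
      Run ((st.advance Ch (r.1.time - st.clock)).arrive r) fut outs → Run st (r :: fut) outs
  -- The strict inequality gives a simultaneous arrival precedence over saturation, so the next
  -- event is unique.
  | saturate (st d fut outs) : st.pick V = none → st.Admits Ch d → st.Saturates Ch d →
      (∀ r ∈ fut, st.clock + d < r.1.time) → Run (st.advance Ch d) fut outs → Run st fut outs

/-- The number of counters that are not full. -/
def State.numUnsaturated (st : State T L) : ℕ :=
  (Finset.univ.filter fun x : T.ι × L => ¬ st.Full x.1 x.2).card

variable {Ch}

theorem State.Admits.full {st : State T L} {d : ℝ} (hd : st.Admits Ch d) {u l}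
    (h : st.Full u l) : (st.advance Ch d).Full u l :=
  h.trans (le_add_of_nonneg_right (mul_nonneg hd.1 (Nat.cast_nonneg _)))

theorem State.Admits.numUnsaturated_le {st : State T L} {d : ℝ} (hd : st.Admits Ch d) :
    (st.advance Ch d).numUnsaturated ≤ st.numUnsaturated := by
  refine Finset.card_le_card fun x hx => ?_
  simp only [Finset.mem_filter, Finset.mem_univ, true_and] at hx ⊢
  exact fun h => hx (hd.full h)

theorem State.Admits.numUnsaturated_lt {st : State T L} {d : ℝ} (hd : st.Admits Ch d)
    (hs : st.Saturates Ch d) :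
    (st.advance Ch d).numUnsaturated < st.numUnsaturated := by
  obtain ⟨u, l, hr, he⟩ := hs
  refine Finset.card_lt_card ⟨fun x hx => ?_, fun hsub => ?_⟩
  · simp only [Finset.mem_filter, Finset.mem_univ, true_and] at hx ⊢
    exact fun h => hx (hd.full h)
  · have hmem : (u, l) ∈ Finset.univ.filter fun x : T.ι × L => ¬ st.Full x.1 x.2 := by
      simp only [Finset.mem_filter, Finset.mem_univ, true_and]
      intro hf
      simp [rate, hf] at hr
    have := hsub hmem
    simp only [Finset.mem_filter, Finset.mem_univ, true_and] at this
    exact this he.ge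

/-- With `K` counters, the measure gives weight `K + 2` to a future and `K + 1` to a pending
request. An arrival trades one for the other, a match frees two pending requests while unsaturating
at most `K` counters, and a saturation lowers the last term. If neither growth nor arrivals remain,
the total charge is zero and `card_pending_le` leaves nothing pending. -/
theorem exists_run (st : State T L) (fut : List (IndexedRequest S L))
    (h : st.Consistent Ch fut) : ∃ outs, Run Ch st fut outs := by
  induction hm : fut.length * (Fintype.card (T.ι × L) + 2) +
    st.pending.card * (Fintype.card (T.ι × L) + 1) + st.numUnsaturated using
    Nat.strong_induction_on generalizing st fut with
  | _ m ih =>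
    subst hm
    cases hp : st.pick V with
    | some p =>
      have hM := matchable_of_pick hp
      have hlt : (st.pair p).numUnsaturated ≤ Fintype.card (T.ι × L) := Finset.card_le_univ _
      have hcard : (st.pair p).pending.card + 2 = st.pending.card := by
        have := sum_pair hM fun _ => 1
        simp only [Finset.sum_const, smul_eq_mul, mul_one] at this
        omega
      obtain ⟨outs, ho⟩ := ih _ (by
        rw [← hcard]
        nlinarith) (st.pair p) fut (h.pair hM) rfl
      exact ⟨_, Run.pair _ _ _ _ hp ho⟩
    | none =>
      have harr : ∀ r fut', fut = r :: fut' → st.Admits Ch (r.1.time - st.clock) →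
          ∃ outs, Run Ch st fut outs := by
        rintro r fut' rfl hd
        have h1 := hd.numUnsaturated_le
        have h2 : ((st.advance Ch (r.1.time - st.clock)).arrive r).numUnsaturated =
          (st.advance Ch (r.1.time - st.clock)).numUnsaturated := rfl
        have h3 : ((st.advance Ch (r.1.time - st.clock)).arrive r).pending.card =
            st.pending.card + 1 :=
          Finset.card_insert_of_notMem (h.fresh r List.mem_cons_self)
        obtain ⟨outs, ho⟩ := ih _ (by
          rw [h2, h3, List.length_cons]
          nlinarith) _ fut' (h.advance_arrive hd) rfl
        exact ⟨_, Run.arrive _ _ _ _ hp hd ho⟩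
      by_cases hr : ∃ u l, 0 < st.rate Ch u l
      · obtain ⟨d, hd, hs⟩ := exists_saturates h hr
        have hsat : (∀ r ∈ fut, st.clock + d < r.1.time) → ∃ outs, Run Ch st fut outs := by
          intro hfut
          have h1 := hd.numUnsaturated_lt hs
          obtain ⟨outs, ho⟩ := ih _ (by
            have : (st.advance Ch d).pending = st.pending := rfl
            rw [this]
            omega) _ fut (h.advance hd fun r hr => (hfut r hr).le) rfl
          exact ⟨_, Run.saturate _ _ _ _ hp hd hs hfut ho⟩
        cases fut with
        | nil => exact hsat (by simp)
        | cons r fut =>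
          by_cases hrt : st.clock + d < r.1.time
          · refine hsat fun r' hr' => ?_
            rcases List.mem_cons.1 hr' with rfl | hr'
            · exact hrt
            · exact hrt.trans_le ((List.pairwise_cons.1 h.sorted).1 r' hr')
          · refine harr r fut rfl ⟨sub_nonneg.2 (h.clock_le r List.mem_cons_self), fun u l => ?_⟩
            refine le_trans ?_ (hd.2 u l)
            gcongr
            linarith
      · push Not at hr
        have hr0 : ∀ u l, st.rate Ch u l = 0 := fun u l => Nat.le_zero.1 (hr u l)
        cases fut with
        | nil =>
          have hc := card_pending_le (Ch := Ch) hp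
          have h0 := h.charge_eq
          simp only [List.map_nil, List.sum_nil, add_zero] at h0
          simp only [hr0, h0, Ch.excess_zero, Finset.sum_const_zero, mul_zero, add_zero] at hc
          exact ⟨_, Run.done _ (Finset.card_eq_zero.1 (Nat.le_zero.1 hc))⟩
        | cons r fut =>
          refine harr r fut rfl ⟨sub_nonneg.2 (h.clock_le r List.mem_cons_self), fun u l => ?_⟩
          rw [hr0]
          simpa using h.counter_le u l

end

/-! ### Causality and completeness of runs -/

section

open State

variable {S : Type u} {L : Type} {V : Variant L} {G : Type} [AddCommGroup G] [Fintype L]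
  {Ch : ChargeSystem.{u} V G} {T : Hierarchy S}

/-- A growing counter that is full after time `d` would overflow later. This fixes the time of the
next saturation and its order relative to arrivals. -/
theorem State.Saturates.le {st : State T L} {d d' : ℝ} (h : st.Saturates Ch d)
    (h' : st.Admits Ch d') : d' ≤ d := by
  obtain ⟨u, l, hr, he⟩ := h
  have := h'.2 u l
  rw [← he] at this
  have hr' : (0 : ℝ) < st.rate Ch u l := by exact_mod_cast hr
  exact le_of_mul_le_mul_right (by linarith) hr'

namespace Run

theorem clock_le {st : State T L} {fut outs} (h : Run Ch st fut outs) :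
    ∀ o ∈ outs, st.clock ≤ o.2 := by
  induction h with
  | done => simp
  | pair st p fut outs hp _ ih =>
    intro o ho
    rcases List.mem_cons.1 ho with rfl | ho
    exacts [le_rfl, ih o ho]
  | arrive st r fut outs _ hd _ ih => exact fun o ho => (le_add_of_nonneg_right hd.1).trans (ih o ho)
  | saturate st d fut outs _ hd _ _ _ ih =>
    exact fun o ho => (le_add_of_nonneg_right hd.1).trans (ih o ho)

theorem filter_eq_nil {st : State T L} {fut outs t} (h : Run Ch st fut outs) (ht : t < st.clock) :
    outs.filter (fun o => decide (o.2 ≤ t)) = [] := by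
  rw [List.filter_eq_nil_iff]
  intro o ho
  simpa using ht.trans_le (h.clock_le o ho)

/-- What is output up to time `t` does not depend on the requests that arrive after time `t`. -/
theorem filter_eq {st : State T L} {pre rest rest' : List (IndexedRequest S L)} {outs outs'}
    {t : ℝ} (h : Run Ch st (pre ++ rest) outs) (h' : Run Ch st (pre ++ rest') outs')
    (hr : ∀ r ∈ rest, t < r.1.time) (hr' : ∀ r ∈ rest', t < r.1.time) :
    outs.filter (fun o => decide (o.2 ≤ t)) = outs'.filter (fun o => decide (o.2 ≤ t)) := by
  generalize hf : pre ++ rest = fut at h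
  -- The runs go through the same states while the common prefix lasts. Once their next events can
  -- differ, one of them is an arrival after `t`, and `Saturates.le` puts a competing saturation no
  -- earlier than that arrival.
  induction h generalizing pre outs' with
  | done st hP =>
    obtain ⟨rfl, rfl⟩ := List.append_eq_nil_iff.1 hf
    rw [List.nil_append] at h'
    cases h' with
    | done => rfl
    | pair _ p _ outs hp => exact absurd (matchable_of_pick hp).1 (by simp [hP])
    | arrive _ r fut outs hp hd h' =>
      have h1 := hr' r List.mem_cons_self
      rw [h'.filter_eq_nil (t := t) (by simpa [State.arrive, State.advance] using h1)]
      rfl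
    | saturate _ d _ outs hp hd hs =>
      obtain ⟨u, l, h0, -⟩ := hs
      simp [rate_eq_zero hP] at h0
  | pair st p fut outs hp h ih =>
    subst hf
    generalize hf' : pre ++ rest' = fut' at h'
    cases h' with
    | done _ hP => exact absurd (matchable_of_pick hp).1 (by simp [hP])
    | pair _ p' _ outs' hp' h' =>
      subst hf'
      obtain rfl := Option.some.inj (hp.symm.trans hp')
      rw [List.filter_cons, List.filter_cons, ih h' rfl]
    | arrive _ r fut outs hp' => simp [hp] at hp'
    | saturate _ d _ outs hp' => simp [hp] at hp'
  | arrive st r fut outs hp hd h ih =>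
    generalize hf' : pre ++ rest' = fut' at h'
    cases pre with
    | nil =>
      rw [List.nil_append] at hf hf'
      subst hf hf'
      have h1 := hr r List.mem_cons_self
      rw [h.filter_eq_nil (t := t) (by simpa [State.arrive, State.advance] using h1)]
      cases h' with
      | done => rfl
      | pair _ p _ outs hp' => simp [hp] at hp'
      | arrive _ r' fut' outs' hp' hd' h' =>
        have h2 := hr' r' List.mem_cons_self
        rw [h'.filter_eq_nil (t := t) (by simpa [State.arrive, State.advance] using h2)]
      | saturate _ d' _ outs' hp' hd' hs' _ h' =>
        have h2 := hs'.le hd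
        rw [h'.filter_eq_nil (t := t) (by simp only [State.advance]; linarith)]
    | cons r' pre =>
      rw [List.cons_append, List.cons.injEq] at hf
      obtain ⟨rfl, rfl⟩ := hf
      rw [List.cons_append] at hf'
      cases h' with
      | done => simp at hf'
      | pair _ p _ outs hp' => simp [hp] at hp'
      | arrive _ r₁ fut' outs' hp' hd' h' =>
        rw [List.cons.injEq] at hf'
        obtain ⟨rfl, rfl⟩ := hf'
        exact ih h' rfl
      | saturate _ d' _ outs' hp' hd' hs' hlt h' =>
        subst hf'
        have h2 := hs'.le hd
        have h3 := hlt r' List.mem_cons_self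
        linarith
  | saturate st d fut outs hp hd hs hlt h ih =>
    subst hf
    generalize hf' : pre ++ rest' = fut' at h'
    cases h' with
    | done _ hP =>
      obtain ⟨u, l, h0, -⟩ := hs
      simp [rate_eq_zero hP] at h0
    | pair _ p _ outs hp' => simp [hp] at hp'
    | arrive _ r' fut' outs' hp' hd' h' =>
      have h2 := hs.le hd'
      cases pre with
      | nil =>
        rw [List.nil_append] at hf'
        subst hf'
        have h1 := hr' r' List.mem_cons_self
        rw [h.filter_eq_nil (t := t) (by simp only [State.advance]; linarith),
          h'.filter_eq_nil (t := t) (by simpa [State.arrive, State.advance] using h1)]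
      | cons r₁ pre =>
        rw [List.cons_append, List.cons.injEq] at hf'
        obtain ⟨rfl, rfl⟩ := hf'
        have h3 := hlt r₁ List.mem_cons_self
        linarith
    | saturate _ d' _ outs' hp' hd' hs' _ h' =>
      obtain rfl : d = d' := le_antisymm (hs'.le hd) (hs.le hd')
      subst hf'
      exact ih h' rfl

/-- Every request is matched exactly once. -/
theorem sum_pairs {st : State T L} {fut outs} (h : Run Ch st fut outs)
    (hc : st.Consistent Ch fut) :
    (outs.map fun o => ({o.1.1, o.1.2} : Multiset (IndexedRequest S L))).sum =
      st.pending.val + (fut : Multiset (IndexedRequest S L)) := by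
  induction h with
  | done st hP => simp [hP]
  | pair st p fut outs hp h ih =>
    have hM := matchable_of_pick hp
    rw [List.map_cons, List.sum_cons, ih (hc.pair hM)]
    have h2 : p.2 ∈ st.pending.val.erase p.1 :=
      (Multiset.mem_erase_of_ne hM.2.2.1.symm).2 hM.2.1
    have h3 : (st.pair p).pending.val = (st.pending.val.erase p.1).erase p.2 := by
      simp [State.pair]
    rw [h3, ← add_assoc]
    congr 1
    rw [Multiset.insert_eq_cons, Multiset.cons_add, Multiset.singleton_add,
      Multiset.cons_erase h2, Multiset.cons_erase hM.1]
  | arrive st r fut outs hp hd h ih =>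
    rw [ih (hc.advance_arrive hd)]
    have : ((st.advance Ch (r.1.time - st.clock)).arrive r).pending.val = r ::ₘ st.pending.val :=
      Finset.insert_val_of_notMem (hc.fresh r List.mem_cons_self)
    rw [this, ← Multiset.cons_coe, Multiset.cons_add, Multiset.add_cons]
  | saturate st d fut outs hp hd hs hlt h ih =>
    exact ih (hc.advance hd fun r hr => (hlt r hr).le)

theorem compat_and_time_le {st : State T L} {fut outs} (h : Run Ch st fut outs)
    (hc : st.Consistent Ch fut) :
    ∀ o ∈ outs, V.compat o.1.1.1.label o.1.2.1.label ∧ o.1.1.1.time ≤ o.2 ∧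
      o.1.2.1.time ≤ o.2 := by
  induction h with
  | done st hP => simp
  | pair st p fut outs hp h ih =>
    have hM := matchable_of_pick hp
    intro o ho
    rcases List.mem_cons.1 ho with rfl | ho
    · exact ⟨hM.2.2.2.1, hc.le_clock _ hM.1, hc.le_clock _ hM.2.1⟩
    · exact ih (hc.pair hM) o ho
  | arrive st r fut outs hp hd h ih => exact ih (hc.advance_arrive hd)
  | saturate st d fut outs hp hd hs hlt h ih =>
    exact ih (hc.advance hd fun r hr => (hlt r hr).le)

end Run

section Pairs

variable {α β : Type*}

theorem ne_of_nodup_sum_pairs {l : List ((α × α) × β)}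
    (h : (l.map fun o => ({o.1.1, o.1.2} : Multiset α)).sum.Nodup) :
    ∀ o ∈ l, o.1.1 ≠ o.1.2 := by
  intro o ho hne
  have hle : ({o.1.1, o.1.2} : Multiset α) ≤
      (l.map fun o => ({o.1.1, o.1.2} : Multiset α)).sum :=
    List.single_le_sum (fun _ _ => Multiset.zero_le _) _ (List.mem_map_of_mem ho)
  have := Multiset.nodup_of_le hle h
  simp [hne] at this

theorem mem_sum_pairs {l : List ((α × α) × β)} {x : α} :
    x ∈ (l.map fun o => ({o.1.1, o.1.2} : Multiset α)).sum ↔ ∃ o ∈ l, x = o.1.1 ∨ x = o.1.2 := by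
  induction l with
  | nil => simp
  | cons o l ih =>
    rw [List.map_cons, List.sum_cons, Multiset.mem_add, ih, List.exists_mem_cons_iff]
    simp only [Multiset.insert_eq_cons, Multiset.mem_cons, Multiset.mem_singleton]

theorem eq_of_nodup_sum_pairs {l : List ((α × α) × β)}
    (h : (l.map fun o => ({o.1.1, o.1.2} : Multiset α)).sum.Nodup) {x : α} {o o' : (α × α) × β}
    (ho : o ∈ l) (ho' : o' ∈ l) (hx : x = o.1.1 ∨ x = o.1.2) (hx' : x = o'.1.1 ∨ x = o'.1.2) :
    o = o' := by
  induction l with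
  | nil => simp at ho
  | cons a l ih =>
    rw [List.map_cons, List.sum_cons, Multiset.nodup_add] at h
    obtain ⟨-, h2, h3⟩ := h
    have key : ∀ b ∈ l, (x = a.1.1 ∨ x = a.1.2) → (x = b.1.1 ∨ x = b.1.2) → False :=
      fun b hb hxa hxb => Multiset.disjoint_left.1 h3 (by simpa using hxa)
        (mem_sum_pairs.2 ⟨b, hb, hxb⟩)
    rcases List.mem_cons.1 ho with ho | ho <;> rcases List.mem_cons.1 ho' with ho' | ho'
    · rw [ho, ho']
    · exact (key _ ho' (ho ▸ hx) hx').elim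
    · exact (key _ ho (ho' ▸ hx') hx).elim
    · exact ih h2 ho ho'

/-- A symmetric sum over the pairs of a perfect matching. -/
theorem two_mul_sum_lt_partner {n : ℕ} (p : Fin n → Fin n) (hp : ∀ i, p (p i) = i)
    (hne : ∀ i, p i ≠ i) (f : Fin n → ℝ) (hf : ∀ i, f (p i) = f i) :
    2 * ∑ i with i < p i, f i = ∑ i, f i := by
  rw [← Finset.sum_filter_add_sum_filter_not Finset.univ (fun i => i < p i), two_mul]
  congr 1
  refine Finset.sum_nbij' p p ?_ ?_ (fun i _ => hp i) (fun i _ => hp i) fun i _ => (hf i).symm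
  · intro i hi
    simp only [Finset.mem_filter, Finset.mem_univ, true_and, hp] at hi ⊢
    exact not_lt.2 hi.le
  · intro i hi
    simp only [Finset.mem_filter, Finset.mem_univ, true_and, hp] at hi ⊢
    exact lt_of_le_of_ne (not_lt.1 hi) (hne i)

end Pairs

/-- The initial state; the clock starts with the first request. -/
def initialState (T : Hierarchy S) (l : List (Request S L)) : State T L where
  clock := (l.head?.map Request.time).getD 0
  counter _ _ := 0
  pending := ∅

theorem initialState_consistent (T : Hierarchy S) (I : Input V S) :
    (initialState T I.requests).Consistent Ch I.requests.zipIdx where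
  counter_nonneg _ _ := le_rfl
  counter_le u _ := mul_nonneg zero_le_two (T.weight_nonneg u)
  sorted := by
    have h := I.sorted
    rw [← List.zipIdx_map_fst 0 I.requests, List.pairwise_map] at h
    exact h
  clock_le r hr := by
    have hr' : r.1 ∈ I.requests := List.fst_mem_of_mem_zipIdx hr
    have h := I.sorted
    revert hr' h
    cases I.requests with
    | nil => simp
    | cons a l =>
      intro hr' h
      simp only [initialState, List.head?_cons, Option.map_some, Option.getD_some]
      rcases List.mem_cons.1 hr' with h' | h'
      · rw [h']
      · exact (List.pairwise_cons.1 h).1 _ h'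
  le_clock r hr := by simp [initialState] at hr
  nodup := List.Nodup.of_map Prod.snd (by
    rw [List.zipIdx_map_snd]
    exact List.nodup_range')
  fresh r _ := by simp [initialState]
  charge_eq := by
    have h := Ch.sum_charge _ I.admissible
    rw [← List.zipIdx_map_fst 0 I.requests, List.map_map, List.map_map] at h
    simpa [initialState, Function.comp_def] using h

end

/-! ### From output lists to an online algorithm -/

section

open State

variable {S : Type u} {L : Type} {V : Variant L} {G : Type} [AddCommGroup G]

/-- A request of an instance together with its position. -/
def Input.indexed (I : Input V S) (i : Fin I.size) : IndexedRequest S L := (I.req i, i)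

theorem Input.indexed_injective (I : Input V S) : Function.Injective I.indexed := fun _ _ h =>
  Fin.ext (congrArg Prod.snd h)

theorem Input.mem_zipIdx (I : Input V S) {x : IndexedRequest S L} :
    x ∈ I.requests.zipIdx ↔ ∃ i, x = I.indexed i := by
  constructor
  · intro h
    have h' := List.mem_zipIdx' h
    exact ⟨⟨x.2, h'.1⟩, Prod.ext h'.2 rfl⟩
  · rintro ⟨i, rfl⟩
    rw [List.mem_zipIdx_iff_getElem?]
    exact List.getElem?_eq_getElem i.2

theorem Input.sum_zipIdx (I : Input V S) (f : IndexedRequest S L → ℝ) :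
    (I.requests.zipIdx.map f).sum = ∑ i, f (I.indexed i) := by
  rw [← List.sum_ofFn]
  congr 1
  refine List.ext_getElem (by simp) fun n h1 h2 => ?_
  simp [Input.indexed]

theorem Input.requests_eq_revealed_append (I : Input V S) (t : ℝ) :
    ∃ l, I.requests = I.revealed t ++ l ∧ ∀ r ∈ l, t < r.time := by
  unfold Input.revealed
  have h := I.sorted
  generalize I.requests = rs at h
  induction rs with
  | nil => exact ⟨[], by simp⟩
  | cons a rs ih =>
    rw [List.pairwise_cons] at h
    by_cases ha : a.time ≤ t
    · obtain ⟨l, hl, hl'⟩ := ih h.2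
      exact ⟨l, by rw [List.filter_cons_of_pos (by simpa using ha), List.cons_append, ← hl], hl'⟩
    · have hall : ∀ r ∈ a :: rs, t < r.time := by
        intro r hr
        rcases List.mem_cons.1 hr with rfl | hr
        exacts [not_le.1 ha, (not_le.1 ha).trans_le (h.1 r hr)]
      refine ⟨a :: rs, ?_, hall⟩
      rw [List.filter_eq_nil_iff.2 fun r hr => by simpa using hall r hr, List.nil_append]

variable [Fintype L] (Ch : ChargeSystem.{u} V G) (T : Hierarchy S)

/-- The output of the algorithm on an instance. -/
def treeOutput (I : Input V S) : List (TimedPair S L) :=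
  (exists_run (Ch := Ch) _ _ (initialState_consistent T I)).choose

theorem treeOutput_run (I : Input V S) :
    Run Ch (initialState T I.requests) I.requests.zipIdx (treeOutput Ch T I) :=
  (exists_run (Ch := Ch) _ _ (initialState_consistent T I)).choose_spec

theorem treeOutput_sum_pairs (I : Input V S) :
    ((treeOutput Ch T I).map fun o => ({o.1.1, o.1.2} : Multiset (IndexedRequest S L))).sum =
      (I.requests.zipIdx : Multiset (IndexedRequest S L)) := by
  rw [(treeOutput_run Ch T I).sum_pairs (initialState_consistent T I)]
  simp [initialState]

theorem treeOutput_nodup (I : Input V S) :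
    ((treeOutput Ch T I).map fun o =>
      ({o.1.1, o.1.2} : Multiset (IndexedRequest S L))).sum.Nodup := by
  rw [treeOutput_sum_pairs]
  exact (initialState_consistent (Ch := Ch) T I).nodup

/-- Two requests are paired by the algorithm at time `s`. -/
def Paired (I : Input V S) (i j : Fin I.size) (s : ℝ) : Prop :=
  ((I.indexed i, I.indexed j), s) ∈ treeOutput Ch T I ∨
    ((I.indexed j, I.indexed i), s) ∈ treeOutput Ch T I

variable {Ch T} {I : Input V S}

theorem Paired.symm {i j : Fin I.size} {s : ℝ} (h : Paired Ch T I i j s) : Paired Ch T I j i s :=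
  Or.symm h

theorem exists_paired (i : Fin I.size) : ∃ j s, Paired Ch T I i j s := by
  have hi : I.indexed i ∈ ((treeOutput Ch T I).map fun o =>
      ({o.1.1, o.1.2} : Multiset (IndexedRequest S L))).sum := by
    rw [treeOutput_sum_pairs]
    exact I.mem_zipIdx.2 ⟨i, rfl⟩
  obtain ⟨⟨⟨a, b⟩, s⟩, ho, hx⟩ := mem_sum_pairs.1 hi
  have hmem : ∀ x, x = a ∨ x = b → ∃ j, x = I.indexed j := by
    intro x hx
    rw [← I.mem_zipIdx, ← Multiset.mem_coe, ← treeOutput_sum_pairs Ch T I]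
    exact mem_sum_pairs.2 ⟨_, ho, hx⟩
  rcases hx with hx | hx
  · obtain ⟨j, hj⟩ := hmem b (Or.inr rfl)
    exact ⟨j, s, Or.inl (by rw [hx, ← hj]; exact ho)⟩
  · obtain ⟨j, hj⟩ := hmem a (Or.inl rfl)
    exact ⟨j, s, Or.inr (by rw [hx, ← hj]; exact ho)⟩

theorem Paired.ne {i j : Fin I.size} {s : ℝ} (h : Paired Ch T I i j s) : i ≠ j := by
  rintro rfl
  rcases h with h | h <;> exact ne_of_nodup_sum_pairs (treeOutput_nodup Ch T I) _ h rfl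

theorem Paired.unique {i j j' : Fin I.size} {s s' : ℝ} (h : Paired Ch T I i j s)
    (h' : Paired Ch T I i j' s') : j = j' ∧ s = s' := by
  have hn := treeOutput_nodup Ch T I
  rcases h with h1 | h1 <;> rcases h' with h2 | h2
  · have := eq_of_nodup_sum_pairs hn h1 h2 (Or.inl rfl) (Or.inl rfl)
    simp only [Prod.mk.injEq] at this
    exact ⟨I.indexed_injective this.1.2, this.2⟩
  · have := eq_of_nodup_sum_pairs hn h1 h2 (Or.inl rfl) (Or.inr rfl)
    simp only [Prod.mk.injEq] at this
    have hij := (Paired.ne (Ch := Ch) (T := T) (s := s) (Or.inl h1))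
    exact absurd (I.indexed_injective this.1.2).symm hij
  · have := eq_of_nodup_sum_pairs hn h1 h2 (Or.inr rfl) (Or.inl rfl)
    simp only [Prod.mk.injEq] at this
    have hij := (Paired.ne (Ch := Ch) (T := T) (s := s) (Or.inr h1))
    exact absurd (I.indexed_injective this.1.1).symm hij
  · have := eq_of_nodup_sum_pairs hn h1 h2 (Or.inr rfl) (Or.inr rfl)
    simp only [Prod.mk.injEq] at this
    exact ⟨I.indexed_injective this.1.1, this.2⟩

variable (Ch T)

/-- The solution that the algorithm outputs. -/
def treeMatching (I : Input V S) : TimedMatching I where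
  partner i := (exists_paired (Ch := Ch) (T := T) i).choose
  outTime i := (exists_paired (Ch := Ch) (T := T) i).choose_spec.choose
  partner_partner i :=
    ((exists_paired _).choose_spec.choose_spec.unique
      (exists_paired (Ch := Ch) (T := T) i).choose_spec.choose_spec.symm).1
  partner_ne i := (exists_paired (Ch := Ch) (T := T) i).choose_spec.choose_spec.ne.symm
  compat i := by
    have h := (exists_paired (Ch := Ch) (T := T) i).choose_spec.choose_spec
    have hr := (treeOutput_run Ch T I).compat_and_time_le (initialState_consistent T I)
    rcases h with h | h
    · exact (hr _ h).1
    · have := (hr _ h).1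
      rw [Ch.compat_iff, add_comm] at this
      exact (Ch.compat_iff _ _).2 this
  outTime_partner i :=
    ((exists_paired _).choose_spec.choose_spec.unique
      (exists_paired (Ch := Ch) (T := T) i).choose_spec.choose_spec.symm).2
  arrival_le i := by
    have h := (exists_paired (Ch := Ch) (T := T) i).choose_spec.choose_spec
    have hr := (treeOutput_run Ch T I).compat_and_time_le (initialState_consistent T I)
    rcases h with h | h
    · exact (hr _ h).2.1
    · exact (hr _ h).2.2

theorem treeMatching_paired (I : Input V S) (i : Fin I.size) :
    Paired Ch T I i ((treeMatching Ch T I).partner i) ((treeMatching Ch T I).outTime i) :=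
  (exists_paired (Ch := Ch) (T := T) i).choose_spec.choose_spec

/-- A sum over the pairs of the solution can be computed from the output list. -/
theorem sum_treeMatching (I : Input V S) (f : Request S L → Request S L → ℝ → ℝ)
    (hf : ∀ a b s, f a b s = f b a s) :
    ∑ i with i < (treeMatching Ch T I).partner i,
      f (I.req i) (I.req ((treeMatching Ch T I).partner i)) ((treeMatching Ch T I).outTime i) =
    ((treeOutput Ch T I).map fun o => f o.1.1.1 o.1.2.1 o.2).sum := by
  set M := treeMatching Ch T I with hM
  set F : IndexedRequest S L → ℝ := fun x => if h : x.2 < I.size then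
    f (I.req ⟨x.2, h⟩) (I.req (M.partner ⟨x.2, h⟩)) (M.outTime ⟨x.2, h⟩) else 0 with hF
  have hFi : ∀ i, F (I.indexed i) = f (I.req i) (I.req (M.partner i)) (M.outTime i) := by
    intro i
    have : (I.indexed i).2 < I.size := i.2
    rw [hF]
    dsimp only
    rw [dif_pos this]
    rfl
  have hFo : ∀ o ∈ treeOutput Ch T I, F o.1.1 = f o.1.1.1 o.1.2.1 o.2 ∧
      F o.1.2 = f o.1.1.1 o.1.2.1 o.2 := by
    intro o ho
    have hmem : ∀ x, x = o.1.1 ∨ x = o.1.2 → ∃ j, x = I.indexed j := by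
      intro x hx
      rw [← I.mem_zipIdx, ← Multiset.mem_coe, ← treeOutput_sum_pairs Ch T I]
      exact mem_sum_pairs.2 ⟨_, ho, hx⟩
    obtain ⟨i, hi⟩ := hmem _ (Or.inl rfl)
    obtain ⟨j, hj⟩ := hmem _ (Or.inr rfl)
    have hp : Paired Ch T I i j o.2 := Or.inl (by rw [← hi, ← hj]; exact ho)
    have h1 := (treeMatching_paired Ch T I i).unique hp
    have h2 := (treeMatching_paired Ch T I j).unique hp.symm
    rw [hi, hj, hFi, hFi, hM, h1.1, h1.2, h2.1, h2.2]
    exact ⟨rfl, hf _ _ _⟩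
  -- The output pairs cover every request exactly once, so a sum over all requests counts each pair
  -- from both ends.
  have key : ∑ i, f (I.req i) (I.req (M.partner i)) (M.outTime i) =
      2 * ((treeOutput Ch T I).map fun o => f o.1.1.1 o.1.2.1 o.2).sum := by
    rw [← Finset.sum_congr rfl fun i _ => hFi i, ← I.sum_zipIdx F, ← Multiset.sum_coe,
      ← Multiset.map_coe, ← treeOutput_sum_pairs Ch T I, ← List.sum_map_mul_left]
    clear_value F M
    generalize treeOutput Ch T I = l at hFo ⊢
    induction l with
    | nil => simp
    | cons o l ih =>
      obtain ⟨h1, h2⟩ := hFo o List.mem_cons_self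
      rw [List.map_cons, List.sum_cons, Multiset.map_add, Multiset.sum_add,
        ih fun o ho => hFo o (List.mem_cons_of_mem _ ho)]
      simp [h1, h2, two_mul]
  have h2 := two_mul_sum_lt_partner M.partner M.partner_partner M.partner_ne
    (fun i => f (I.req i) (I.req (M.partner i)) (M.outTime i)) fun i => by
      rw [M.partner_partner, M.outTime_partner, hf]
  rw [key] at h2
  exact mul_left_cancel₀ two_ne_zero h2

theorem onlineCost_treeMatching [PseudoMetricSpace S] (I : Input V S) :
    (treeMatching Ch T I).onlineCost = ((treeOutput Ch T I).map fun o =>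
      dist o.1.1.1.point o.1.2.1.point + ((o.2 - o.1.1.1.time) + (o.2 - o.1.2.1.time))).sum := by
  rw [← sum_treeMatching Ch T I
    (fun a b s => dist a.point b.point + ((s - a.time) + (s - b.time)))
    (fun a b s => by rw [dist_comm, add_comm (s - a.time)])]
  exact Finset.sum_add_distrib.symm

theorem treeOutput_filter_eq (I J : Input V S) (t : ℝ) (h : I.revealed t = J.revealed t) :
    (treeOutput Ch T I).filter (fun o => decide (o.2 ≤ t)) =
      (treeOutput Ch T J).filter (fun o => decide (o.2 ≤ t)) := by
  obtain ⟨l, hl, hlt⟩ := I.requests_eq_revealed_append t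
  obtain ⟨l', hl', hlt'⟩ := J.requests_eq_revealed_append t
  rw [← h] at hl'
  have hI := treeOutput_run Ch T I
  have hJ := treeOutput_run Ch T J
  generalize treeOutput Ch T I = o at hI
  generalize treeOutput Ch T J = o' at hJ
  rw [hl] at hI
  rw [hl'] at hJ
  generalize I.revealed t = pre at hI hJ
  cases pre with
  | nil =>
    -- The initial clock is read off the first request, so runs share an initial state only if one
    -- is revealed. Otherwise the input is empty or its run starts after `t`.
    have key : ∀ (k : List (Request S L)) o, (∀ r ∈ k, t < r.time) →
        Run Ch (initialState T k) k.zipIdx o → o.filter (fun o => decide (o.2 ≤ t)) = [] := by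
      intro k o hk hr
      cases k with
      | nil =>
        have := hr.sum_pairs (by
          exact ⟨fun _ _ => le_rfl, fun u _ => mul_nonneg zero_le_two (T.weight_nonneg u),
            by simp, by simp, by simp [initialState], by simp, by simp,
            by simp [initialState]⟩)
        rw [List.filter_eq_nil_iff]
        intro x hx
        have : x.1.1 ∈ (o.map fun o => ({o.1.1, o.1.2} : Multiset (IndexedRequest S L))).sum :=
          mem_sum_pairs.2 ⟨x, hx, Or.inl rfl⟩
        simp_all [initialState]
      | cons a k =>
        exact hr.filter_eq_nil (by simpa [initialState] using hk a List.mem_cons_self)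
    rw [List.nil_append] at hI hJ
    rw [key l o hlt hI, key l' o' hlt' hJ]
  | cons a pre =>
    rw [List.zipIdx_append] at hI hJ
    have hst : ∀ k, initialState T ((a :: pre) ++ k) = initialState T [a] := fun _ => rfl
    rw [hst] at hI hJ
    refine hI.filter_eq hJ ?_ ?_
    · exact fun r hr => hlt _ (List.fst_mem_of_mem_zipIdx hr)
    · exact fun r hr => hlt' _ (List.fst_mem_of_mem_zipIdx hr)

theorem mem_outputUpTo_treeMatching (I : Input V S) (t : ℝ) (x : ℕ × ℕ × ℝ) :
    x ∈ (treeMatching Ch T I).outputUpTo t ↔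
      ∃ o ∈ (treeOutput Ch T I).filter (fun o => decide (o.2 ≤ t)),
        x = (o.1.1.2, o.1.2.2, o.2) ∨ x = (o.1.2.2, o.1.1.2, o.2) := by
  simp only [List.mem_filter, decide_eq_true_eq]
  constructor
  · rintro ⟨i, hi, rfl⟩
    rcases treeMatching_paired Ch T I i with h | h
    · exact ⟨_, ⟨h, hi⟩, Or.inl rfl⟩
    · exact ⟨_, ⟨h, hi⟩, Or.inr rfl⟩
  · rintro ⟨o, ⟨ho, hot⟩, hx⟩
    have hmem : ∀ x, x = o.1.1 ∨ x = o.1.2 → ∃ j, x = I.indexed j := by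
      intro x hx
      rw [← I.mem_zipIdx, ← Multiset.mem_coe, ← treeOutput_sum_pairs Ch T I]
      exact mem_sum_pairs.2 ⟨_, ho, hx⟩
    obtain ⟨i, hi⟩ := hmem _ (Or.inl rfl)
    obtain ⟨j, hj⟩ := hmem _ (Or.inr rfl)
    have hp : Paired Ch T I i j o.2 := Or.inl (by rw [← hi, ← hj]; exact ho)
    have h1 := (treeMatching_paired Ch T I i).unique hp
    have h2 := (treeMatching_paired Ch T I j).unique hp.symm
    rw [hi, hj] at hx
    rcases hx with rfl | rfl
    · exact ⟨i, by rw [h1.2]; exact hot, by rw [h1.1, h1.2]; rfl⟩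
    · exact ⟨j, by rw [h2.2]; exact hot, by rw [h2.1, h2.2]; rfl⟩

/-- The deterministic online algorithm on a tree. -/
def treeAlgorithm : OnlineAlgorithm V S where
  run I := treeMatching Ch T I
  causal I J t h := by
    ext x
    rw [mem_outputUpTo_treeMatching, mem_outputUpTo_treeMatching, treeOutput_filter_eq Ch T I J t h]

end

/-! ### Potential analysis against an offline solution -/

section

open State

variable {S : Type u} {L : Type} {G : Type} [AddCommGroup G]

/-- `Offline V T Q fut c D` means that the requests `fut`, arriving while the requests `Q` are
pending, can be matched with each other and with `Q` by pairs of total tree distance `c` and total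
time difference `D`. -/
inductive Offline (V : Variant L) (T : Hierarchy S) :
    Finset (IndexedRequest S L) → List (IndexedRequest S L) → ℝ → ℝ → Prop
  | nil : Offline V T ∅ [] 0 0
  | wait (Q r fut c D) : Offline V T (insert r Q) fut c D → Offline V T Q (r :: fut) c D
  | serve (Q r q fut c D) : q ∈ Q → V.compat q.1.label r.1.label →
      Offline V T (Q.erase q) fut c D →
      Offline V T Q (r :: fut) (c + T.treeDist q.1.point r.1.point) (D + (r.1.time - q.1.time))

variable {V : Variant L} [Fintype L] {T : Hierarchy S}

namespace ChargeSystem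

variable (Ch : ChargeSystem.{u} V G)

theorem surplus_insert {P : Finset (IndexedRequest S L)} {r} (hr : r ∉ P) (A : Set S) :
    Ch.surplus (insert r P) A =
      Ch.surplus P A + if r.1.point ∈ A then Ch.charge r.1.label else 0 := by
  unfold surplus
  rw [Finset.sum_filter, Finset.sum_filter, Finset.sum_insert hr, add_comm]

theorem surplus_erase {P : Finset (IndexedRequest S L)} {r} (hr : r ∈ P) (A : Set S) :
    Ch.surplus (P.erase r) A =
      Ch.surplus P A - if r.1.point ∈ A then Ch.charge r.1.label else 0 := by
  rw [eq_sub_iff_add_eq, ← Ch.surplus_insert (Finset.notMem_erase r P), Finset.insert_erase hr]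

theorem sum_excess_le_card {α : Type*} (R : Finset α) (lab : α → L) :
    ∑ l, Ch.excess l (∑ a ∈ R, Ch.charge (lab a)) ≤ R.card := by
  induction R using Finset.induction_on with
  | empty => simp [Ch.excess_zero]
  | insert a R ha ih =>
    rw [Finset.sum_insert ha, Finset.card_insert_of_notMem ha, add_comm]
    exact (Ch.sum_excess_add_le _ _).trans (Nat.add_le_add_right ih 1)

/-- Double counting: a request adds at most one to the total excess of each cluster around it, and
there are at most `H` of these. -/
theorem sum_excess_surplus_le {H : ℕ}
    (hH : ∀ p, (Finset.univ.filter fun u => p ∈ T.cluster u).card ≤ H)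
    (Q : Finset (IndexedRequest S L)) :
    ∑ u, ∑ l, Ch.excess l (Ch.surplus Q (T.cluster u)) ≤ H * Q.card := by
  calc ∑ u, ∑ l, Ch.excess l (Ch.surplus Q (T.cluster u))
      ≤ ∑ u, (Q.filter fun a => a.1.point ∈ T.cluster u).card :=
        Finset.sum_le_sum fun u _ => Ch.sum_excess_le_card _ _
    _ = ∑ a ∈ Q, (Finset.univ.filter fun u => a.1.point ∈ T.cluster u).card := by
        simp only [Finset.card_filter]
        exact Finset.sum_comm
    _ ≤ ∑ a ∈ Q, H := Finset.sum_le_sum fun a _ => hH _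
    _ = H * Q.card := by rw [Finset.sum_const, smul_eq_mul, mul_comm]

end ChargeSystem

variable (Ch : ChargeSystem.{u} V G)

namespace State

/-- The potential of a state with respect to the set `Q` of requests that are pending offline. -/
def potential (st : State T L) (Q : Finset (IndexedRequest S L)) : ℝ :=
  ∑ u, ∑ l, counterPotential (2 * T.weight u)
    (Ch.excess l (Ch.surplus st.pending (T.cluster u) - Ch.surplus Q (T.cluster u)))
    (st.counter u l)

/-- The sum of all counters. -/
def totalCounter (st : State T L) : ℝ := ∑ u, ∑ l, st.counter u l

/-- The bound on the cost yet to be paid by the algorithm. -/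
def costBound (H : ℕ) (st : State T L) (Q : Finset (IndexedRequest S L)) (c D : ℝ) : ℝ :=
  -- The weight `5 / 2 = 2 + 1 / 2` covers waiting at twice the growth rate and the rise of half the
  -- counters. It forces `5` on `c`, since an offline pair raises the potential by up to twice its
  -- tree distance, and `5 * H + 1` on the offline delay still to come, the last bracket.
  ∑ a ∈ st.pending, (st.clock - a.1.time) + (5 / 2 * st.potential Ch Q + 1 / 2 * st.totalCounter) +
    5 * c + (5 * H + 1) * (D - ∑ q ∈ Q, (st.clock - q.1.time))

variable {Ch}

theorem Consistent.potential_nonneg {st : State T L} {fut} (h : st.Consistent Ch fut)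
    (Q : Finset (IndexedRequest S L)) : 0 ≤ st.potential Ch Q :=
  Finset.sum_nonneg fun u _ => Finset.sum_nonneg fun l _ =>
    counterPotential_nonneg _ (h.counter_nonneg u l) (h.counter_le u l)

/-- The charges of the pair cancel in a cluster containing both requests; in a separating cluster
the full counter of the inner request is reset, as `potential_sub_le` requires. -/
theorem Consistent.potential_pair_le {st : State T L} {fut} (h : st.Consistent Ch fut) {p}
    (hp : st.Matchable V p) (Q : Finset (IndexedRequest S L)) :
    (st.pair p).potential Ch Q ≤ st.potential Ch Q := by
  refine Finset.sum_le_sum fun u _ => ?_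
  have hch := (Ch.compat_iff _ _).1 hp.2.2.2.1
  have h2 : p.2 ∈ st.pending.erase p.1 := Finset.mem_erase.2 ⟨hp.2.2.1.symm, hp.2.1⟩
  have hs : Ch.surplus (st.pair p).pending (T.cluster u) =
      Ch.surplus st.pending (T.cluster u) -
        (if p.1.1.point ∈ T.cluster u then Ch.charge p.1.1.label else 0) -
        (if p.2.1.point ∈ T.cluster u then Ch.charge p.2.1.label else 0) := by
    rw [← Ch.surplus_erase hp.1, ← Ch.surplus_erase h2]
    rfl
  rw [hs]
  have hfull : ∀ l, OnPath p u l → st.counter u l = 2 * T.weight u := fun l hl =>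
    le_antisymm (h.counter_le u l) (hp.2.2.2.2 u l hl)
  by_cases h1 : p.1.1.point ∈ T.cluster u <;> by_cases h2 : p.2.1.point ∈ T.cluster u
  · simp only [State.pair, OnPath, h1, h2, not_true_eq_false, false_and, and_false, or_self, if_true,
      if_false]
    rw [sub_sub (Ch.surplus st.pending (T.cluster u)), hch, sub_zero]
  · have := Ch.potential_sub_le p.1.1.label
      (Ch.surplus st.pending (T.cluster u) - Ch.surplus Q (T.cluster u)) _ (st.counter u)
      (h.counter_nonneg u) (h.counter_le u) (hfull _ (Or.inl ⟨h1, h2, rfl⟩))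
    simpa only [State.pair, OnPath, h1, h2, not_true_eq_false, not_false_eq_true, true_and,
      false_and, and_false, or_false, if_true, if_false, sub_zero, sub_right_comm] using this
  · have := Ch.potential_sub_le p.2.1.label
      (Ch.surplus st.pending (T.cluster u) - Ch.surplus Q (T.cluster u)) _ (st.counter u)
      (h.counter_nonneg u) (h.counter_le u) (hfull _ (Or.inr ⟨h2, h1, rfl⟩))
    simpa only [State.pair, OnPath, h1, h2, not_true_eq_false, not_false_eq_true, true_and,
      false_and, and_false, false_or, if_true, if_false, sub_zero, sub_right_comm] using this
  · simp only [State.pair, OnPath, h1, h2, false_and, or_self, if_false, sub_zero]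
    exact le_rfl

/-- Each separating cluster has exactly one counter reset, from at least twice the weight to zero;
half of this drop is its share of the tree distance. -/
theorem treeDist_add_totalCounter_le {st : State T L} {p} (hp : st.Matchable V p) :
    T.treeDist p.1.1.point p.2.1.point + 1 / 2 * (st.pair p).totalCounter ≤
      1 / 2 * st.totalCounter := by
  unfold Hierarchy.treeDist totalCounter
  rw [Finset.mul_sum, Finset.mul_sum, ← Finset.sum_add_distrib]
  refine Finset.sum_le_sum fun u _ => ?_
  have key : ∀ l₀, st.Full u l₀ → (∀ l, OnPath p u l ↔ l = l₀) →
      T.weight u + 1 / 2 * ∑ l, (st.pair p).counter u l ≤ 1 / 2 * ∑ l, st.counter u l := by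
    intro l₀ hl₀ hl
    have hl₀' : 2 * T.weight u ≤ st.counter u l₀ := hl₀
    rw [← Finset.add_sum_erase _ _ (Finset.mem_univ l₀),
      ← Finset.add_sum_erase _ (st.counter u) (Finset.mem_univ l₀)]
    have h1 : (st.pair p).counter u l₀ = 0 := by simp [State.pair, hl]
    have h2 : ∑ l ∈ Finset.univ.erase l₀, (st.pair p).counter u l =
        ∑ l ∈ Finset.univ.erase l₀, st.counter u l :=
      Finset.sum_congr rfl fun l hl' => by simp [State.pair, hl, Finset.ne_of_mem_erase hl']
    rw [h1, h2]
    linarith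
  by_cases h1 : p.1.1.point ∈ T.cluster u <;> by_cases h2 : p.2.1.point ∈ T.cluster u
  · simp [State.pair, OnPath, h1, h2]
  · simpa only [h1, h2, iff_false, not_true_eq_false, if_false] using
      key p.1.1.label (hp.2.2.2.2 _ _ (Or.inl ⟨h1, h2, rfl⟩)) fun l => by simp [OnPath, h1, h2]
  · simpa only [h1, h2, iff_true, if_false] using
      key p.2.1.label (hp.2.2.2.2 _ _ (Or.inr ⟨h2, h1, rfl⟩)) fun l => by simp [OnPath, h1, h2]
  · simp [State.pair, OnPath, h1, h2]

/-- Where the difference has an excess, growth and potential cancel. Elsewhere the rate is at most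
the offline excess and counts twice, once by itself and once in the potential, whence `2 * H`. -/
theorem sum_rate_add_potential_advance_le {st : State T L} {d : ℝ} (hd : 0 ≤ d) {H : ℕ}
    (hH : ∀ p, (Finset.univ.filter fun u => p ∈ T.cluster u).card ≤ H)
    (Q : Finset (IndexedRequest S L)) :
    d * ((∑ u, ∑ l, st.rate Ch u l : ℕ) : ℝ) + (st.advance Ch d).potential Ch Q ≤
      st.potential Ch Q + 2 * H * d * Q.card := by
  have h1 : ((∑ u, ∑ l, Ch.excess l (Ch.surplus Q (T.cluster u)) : ℕ) : ℝ) ≤ H * Q.card := by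
    exact_mod_cast Ch.sum_excess_surplus_le hH Q
  have h2 : d * ((∑ u, ∑ l, st.rate Ch u l : ℕ) : ℝ) + (st.advance Ch d).potential Ch Q ≤
      st.potential Ch Q +
        2 * d * ((∑ u, ∑ l, Ch.excess l (Ch.surplus Q (T.cluster u)) : ℕ) : ℝ) := by
    unfold potential
    push_cast
    simp only [Finset.mul_sum, ← Finset.sum_add_distrib]
    refine Finset.sum_le_sum fun u _ => Finset.sum_le_sum fun l _ => ?_
    have hexc := Ch.excess_le l (Ch.surplus st.pending (T.cluster u)) (Ch.surplus Q (T.cluster u))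
    have hrate : st.rate Ch u l ≤ Ch.excess l (Ch.surplus st.pending (T.cluster u)) := by
      unfold rate
      split_ifs
      exacts [Nat.zero_le _, le_rfl]
    change d * (st.rate Ch u l : ℝ) + counterPotential (2 * T.weight u)
      (Ch.excess l (Ch.surplus st.pending (T.cluster u) - Ch.surplus Q (T.cluster u)))
      (st.counter u l + d * st.rate Ch u l) ≤ _
    unfold counterPotential
    split_ifs with h
    · have : (st.rate Ch u l : ℝ) ≤ Ch.excess l (Ch.surplus Q (T.cluster u)) := by
        exact_mod_cast hrate.trans (hexc h)
      nlinarith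
    · have : (0 : ℝ) ≤ 2 * d * Ch.excess l (Ch.surplus Q (T.cluster u)) := by positivity
      linarith
  nlinarith

theorem totalCounter_advance (st : State T L) (d : ℝ) :
    (st.advance Ch d).totalCounter =
      st.totalCounter + d * ((∑ u, ∑ l, st.rate Ch u l : ℕ) : ℝ) := by
  unfold totalCounter advance
  push_cast
  simp only [Finset.mul_sum, ← Finset.sum_add_distrib]

/-- A request that is kept waiting offline joins both pending sets, and their difference is
unchanged. -/
theorem potential_arrive_insert (st : State T L) {r} (hr : r ∉ st.pending)
    {Q : Finset (IndexedRequest S L)} (hr' : r ∉ Q) :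
    (st.arrive r).potential Ch (insert r Q) = st.potential Ch Q := by
  unfold potential
  refine Finset.sum_congr rfl fun u _ => Finset.sum_congr rfl fun l _ => ?_
  rw [arrive, Ch.surplus_insert hr, Ch.surplus_insert hr', add_sub_add_right_eq_sub]

/-- The difference gains the charges of `q` and `r`, which cancel except in clusters separating
their points; there the price is the capacity, twice the weight. -/
theorem potential_arrive_erase_le {st : State T L} (h0 : ∀ u l, 0 ≤ st.counter u l)
    (hle : ∀ u l, st.counter u l ≤ 2 * T.weight u) {r} (hr : r ∉ st.pending) {Q : Finset (IndexedRequest S L)} {q}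
    (hq : q ∈ Q) (hc : V.compat q.1.label r.1.label) :
    (st.arrive r).potential Ch (Q.erase q) ≤
      st.potential Ch Q + 2 * T.treeDist q.1.point r.1.point := by
  unfold potential Hierarchy.treeDist
  rw [Finset.mul_sum, ← Finset.sum_add_distrib]
  refine Finset.sum_le_sum fun u _ => ?_
  have hch := (Ch.compat_iff _ _).1 hc
  have hs : Ch.surplus (st.arrive r).pending (T.cluster u) - Ch.surplus (Q.erase q) (T.cluster u) =
      Ch.surplus st.pending (T.cluster u) - Ch.surplus Q (T.cluster u) +
      ((if q.1.point ∈ T.cluster u then Ch.charge q.1.label else 0) +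
        if r.1.point ∈ T.cluster u then Ch.charge r.1.label else 0) := by
    rw [State.arrive, Ch.surplus_insert hr, Ch.surplus_erase hq]
    abel
  rw [hs]
  have hadd := fun l => Ch.potential_add_le l
    (Ch.surplus st.pending (T.cluster u) - Ch.surplus Q (T.cluster u)) _ (st.counter u)
    (h0 u) (hle u)
  by_cases h1 : q.1.point ∈ T.cluster u <;> by_cases h2 : r.1.point ∈ T.cluster u
  · simp [h1, h2, hch, State.arrive]
  · simpa [h1, h2, State.arrive] using hadd q.1.label
  · simpa [h1, h2, State.arrive] using hadd r.1.label
  · simp [h1, h2, State.arrive]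

theorem Consistent.costBound_pair_le {st : State T L} {fut} (h : st.Consistent Ch fut) {p}
    (hp : st.Matchable V p) (H : ℕ) (Q : Finset (IndexedRequest S L)) (c D : ℝ) :
    T.treeDist p.1.1.point p.2.1.point +
        ((st.clock - p.1.1.time) + (st.clock - p.2.1.time)) +
        (st.pair p).costBound Ch H Q c D ≤ st.costBound Ch H Q c D := by
  unfold costBound
  rw [sum_pair hp]
  have h1 := h.potential_pair_le hp Q
  have h2 := treeDist_add_totalCounter_le hp
  have h3 : (st.pair p).clock = st.clock := rfl
  rw [h3]
  linarith

/-- With total rate `R`, waiting grows at rate at most `2R + |Q|` and half the counters at rate `R /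
2`. The potential absorbs `5R / 2` at the expense of `5H|Q|`, and the offline delay pays all terms
in `|Q|`. -/
theorem costBound_advance_le {st : State T L} {d : ℝ} (hd : 0 ≤ d)
    (hp : st.pick V = none) {H : ℕ}
    (hH : ∀ p, (Finset.univ.filter fun u => p ∈ T.cluster u).card ≤ H)
    {Q : Finset (IndexedRequest S L)}
    (hQ : ∑ a ∈ st.pending, Ch.charge a.1.label = ∑ a ∈ Q, Ch.charge a.1.label) (c D : ℝ) :
    (st.advance Ch d).costBound Ch H Q c D ≤ st.costBound Ch H Q c D := by
  have h1 := card_pending_le (Ch := Ch) hp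
  rw [hQ] at h1
  have h2 := h1.trans (Nat.add_le_add_left (Ch.sum_excess_le_card Q fun a => a.1.label) _)
  have h3 : (st.pending.card : ℝ) ≤ 2 * ((∑ u, ∑ l, st.rate Ch u l : ℕ) : ℝ) + Q.card := by
    exact_mod_cast h2
  have h4 := sum_rate_add_potential_advance_le (Ch := Ch) (st := st) hd hH Q
  have h5 : ∀ P : Finset (IndexedRequest S L),
      ∑ a ∈ P, (st.clock + d - a.1.time) = ∑ a ∈ P, (st.clock - a.1.time) + d * P.card := by
    intro P
    rw [mul_comm, ← nsmul_eq_mul, ← Finset.sum_const, ← Finset.sum_add_distrib]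
    exact Finset.sum_congr rfl fun _ _ => by ring
  have h6 := mul_le_mul_of_nonneg_left h3 hd
  unfold costBound
  rw [totalCounter_advance]
  have h7 : (st.advance Ch d).clock = st.clock + d := rfl
  have h8 : (st.advance Ch d).pending = st.pending := rfl
  rw [h7, h8, h5, h5]
  linarith

end State

variable {Ch}

/-- The cost of the algorithm from a state on, compared with any offline solution. -/
theorem Run.cost_le [PseudoMetricSpace S] (hT : ∀ p q, dist p q ≤ T.treeDist p q) {H : ℕ}
    (hH : ∀ p, (Finset.univ.filter fun u => p ∈ T.cluster u).card ≤ H)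
    {st : State T L} {fut outs} (h : Run Ch st fut outs) (hc : st.Consistent Ch fut)
    {Q : Finset (IndexedRequest S L)} {c D : ℝ} (hQ : Offline V T Q fut c D)
    (hfresh : ∀ r ∈ fut, r ∉ Q)
    (hcharge : ∑ a ∈ st.pending, Ch.charge a.1.label = ∑ a ∈ Q, Ch.charge a.1.label) :
    (outs.map fun o : TimedPair S L => dist o.1.1.1.point o.1.2.1.point +
      ((o.2 - o.1.1.1.time) + (o.2 - o.1.2.1.time))).sum ≤ st.costBound Ch H Q c D := by
  induction h generalizing Q c D with
  | done st hP =>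
    cases hQ
    have h1 := hc.potential_nonneg ∅
    have h2 : 0 ≤ st.totalCounter :=
      Finset.sum_nonneg fun u _ => Finset.sum_nonneg fun l _ => hc.counter_nonneg u l
    simp only [List.map_nil, List.sum_nil, costBound, hP, Finset.sum_empty]
    linarith
  | pair st p fut outs hp h ih =>
    have hM := matchable_of_pick hp
    have h1 := hc.costBound_pair_le hM H Q c D
    have h2 := hT p.1.1.point p.2.1.point
    have h3 := ih (hc.pair hM) hQ hfresh (by
      rw [← hcharge, sum_pair hM, ← add_assoc, (Ch.compat_iff _ _).1 hM.2.2.2.1, zero_add])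
    rw [List.map_cons, List.sum_cons]
    linarith
  | saturate st d fut outs hp hd hs hlt h ih =>
    exact (ih (hc.advance hd fun r hr => (hlt r hr).le) hQ hfresh hcharge).trans
      (costBound_advance_le hd.1 hp hH hcharge c D)
  | arrive st r fut outs hp hd h ih =>
    refine le_trans ?_ (costBound_advance_le hd.1 hp hH hcharge c D)
    have hc' := hc.advance_arrive hd
    have hnonneg : ∀ u l, 0 ≤ (st.advance Ch (r.1.time - st.clock)).counter u l := fun u l =>
      add_nonneg (hc.counter_nonneg u l) (mul_nonneg hd.1 (Nat.cast_nonneg _))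
    have hle : ∀ u l, (st.advance Ch (r.1.time - st.clock)).counter u l ≤ 2 * T.weight u := hd.2
    have hrP : r ∉ (st.advance Ch (r.1.time - st.clock)).pending := hc.fresh r List.mem_cons_self
    have hrQ := hfresh r List.mem_cons_self
    have hclock : (st.advance Ch (r.1.time - st.clock)).clock = r.1.time := add_sub_cancel _ _
    have hcharge' : ∑ a ∈ (st.advance Ch (r.1.time - st.clock)).pending, Ch.charge a.1.label =
      ∑ a ∈ Q, Ch.charge a.1.label := hcharge
    have hnr : ∀ r' ∈ fut, r' ≠ r := by
      rintro r' hr' rfl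
      exact (List.nodup_cons.1 hc.nodup).1 hr'
    generalize st.advance Ch (r.1.time - st.clock) = st' at *
    have hpend : (st'.arrive r).pending = insert r st'.pending := rfl
    cases hQ with
    | wait _ _ _ _ _ hQ =>
      refine (ih hc' hQ ?_ ?_).trans (le_of_eq ?_)
      · intro r' hr' hmem
        rcases Finset.mem_insert.1 hmem with rfl | hmem
        · exact hnr _ hr' rfl
        · exact hfresh r' (List.mem_cons_of_mem _ hr') hmem
      · rw [hpend, Finset.sum_insert hrP, Finset.sum_insert hrQ, hcharge']
      · unfold costBound
        rw [potential_arrive_insert st' hrP hrQ, hpend, Finset.sum_insert hrP,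
          Finset.sum_insert hrQ]
        have h1 : (st'.arrive r).clock = st'.clock := rfl
        have h2 : (st'.arrive r).totalCounter = st'.totalCounter := rfl
        rw [h1, h2, hclock]
        ring
    | serve _ _ q _ c D hq hqr hQ =>
      refine (ih hc' hQ ?_ ?_).trans ?_
      · exact fun r' hr' hmem => hfresh r' (List.mem_cons_of_mem _ hr') (Finset.mem_of_mem_erase hmem)
      · rw [hpend, Finset.sum_insert hrP, hcharge', ← Finset.add_sum_erase _ _ hq, ← add_assoc,
          add_comm (Ch.charge _), (Ch.compat_iff _ _).1 hqr, zero_add]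
      · unfold costBound
        have h3 := potential_arrive_erase_le (Ch := Ch) hnonneg hle hrP hq hqr
        rw [hpend, Finset.sum_insert hrP, ← Finset.add_sum_erase Q _ hq]
        have h1 : (st'.arrive r).clock = st'.clock := rfl
        have h2 : (st'.arrive r).totalCounter = st'.totalCounter := rfl
        rw [h1, h2, hclock]
        linarith

end

/-! ### Replaying a perfect matching in order of arrival -/

section

open State

variable {S : Type u} {L : Type} {V : Variant L} {G : Type} [AddCommGroup G] {I : Input V S}

/-- The total tree distance over the pairs of a solution. -/
def PerfectMatching.treeCost (M : PerfectMatching I) (T : Hierarchy S) : ℝ :=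
  ∑ i with i < M.partner i, T.treeDist (I.req i).point (I.req (M.partner i)).point

theorem Input.drop_zipIdx (I : Input V S) (k : Fin I.size) :
    I.requests.zipIdx.drop k = I.indexed k :: I.requests.zipIdx.drop (k + 1) := by
  rw [List.drop_eq_getElem_cons (by simp)]
  simp [Input.indexed]

/-- Just before position `k`, the requests waiting offline are the earlier ones whose partner is yet
to come. Each pair is charged at its later member, hence the index conditions in the sums. -/
theorem PerfectMatching.offline_drop (M : PerfectMatching I) (T : Hierarchy S) (n k : ℕ)
    (hk : n + k = I.size) :
    Offline V T
      ((Finset.univ.filter fun i : Fin I.size => i.1 < k ∧ k ≤ (M.partner i).1).image I.indexed)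
      (I.requests.zipIdx.drop k)
      (∑ i with k ≤ i.1 ∧ M.partner i < i, T.treeDist (I.req (M.partner i)).point (I.req i).point)
      (∑ i with k ≤ i.1 ∧ M.partner i < i, ((I.req i).time - (I.req (M.partner i)).time)) := by
  induction n generalizing k with
  | zero =>
    have h1 : (Finset.univ.filter fun i : Fin I.size => i.1 < k ∧ k ≤ (M.partner i).1) = ∅ := by
      refine Finset.filter_eq_empty_iff.2 fun i _ h => ?_
      have := (M.partner i).2
      omega
    have h2 : (Finset.univ.filter fun i : Fin I.size => k ≤ i.1 ∧ M.partner i < i) = ∅ := by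
      refine Finset.filter_eq_empty_iff.2 fun i _ h => ?_
      have := i.2
      omega
    rw [h1, h2, List.drop_eq_nil_of_le (by
      rw [List.length_zipIdx]; exact (by omega : I.size ≤ k))]
    simpa using Offline.nil
  | succ n ih =>
    have ih := ih (k + 1) (by omega)
    have hlt : k < I.size := by omega
    obtain ⟨j, rfl⟩ : ∃ j : Fin I.size, k = j.1 := ⟨⟨k, hlt⟩, rfl⟩
    rw [I.drop_zipIdx j]
    have hpp : ∀ i, M.partner i = j → i = M.partner j := fun i h => by
      rw [← h, M.partner_partner]
    rcases lt_or_gt_of_ne (M.partner_ne j) with hp | hp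
    · have hsum : (Finset.univ.filter fun i : Fin I.size => j.1 ≤ i.1 ∧ M.partner i < i) =
          insert j (Finset.univ.filter fun i : Fin I.size => j.1 + 1 ≤ i.1 ∧ M.partner i < i) := by
        ext i
        simp only [Finset.mem_filter, Finset.mem_univ, true_and, Finset.mem_insert]
        constructor
        · rintro ⟨h1, h2⟩
          by_cases hij : i = j
          · exact Or.inl hij
          · exact Or.inr ⟨by have : i.1 ≠ j.1 := fun h => hij (Fin.ext h)
                             omega, h2⟩
        · rintro (rfl | ⟨h1, h2⟩)
          · exact ⟨le_rfl, hp⟩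
          · exact ⟨by omega, h2⟩
      have hj : j ∉ (Finset.univ.filter fun i : Fin I.size => j.1 + 1 ≤ i.1 ∧ M.partner i < i) := by
        simp
      rw [hsum, Finset.sum_insert hj, Finset.sum_insert hj, add_comm (T.treeDist _ _),
        add_comm (_ - _)]
      refine Offline.serve _ (I.indexed j) (I.indexed (M.partner j)) _ _ _ ?_ ?_ ?_
      · refine Finset.mem_image_of_mem _ ?_
        simp only [Finset.mem_filter, Finset.mem_univ, true_and, M.partner_partner]
        exact ⟨hp, le_rfl⟩
      · have := M.compat (M.partner j)
        rwa [M.partner_partner] at this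
      · rw [← Finset.image_erase I.indexed_injective]
        convert ih using 2
        ext i
        simp only [Finset.mem_filter, Finset.mem_univ, true_and, Finset.mem_erase]
        constructor
        · rintro ⟨h1, h2, h3⟩
          refine ⟨by omega, ?_⟩
          have : (M.partner i).1 ≠ j.1 := fun h => h1 (hpp i (Fin.ext h))
          omega
        · rintro ⟨h1, h2⟩
          refine ⟨?_, ?_, by omega⟩
          · rintro rfl
            rw [M.partner_partner] at h2
            omega
          · have : i.1 ≠ j.1 := by
              intro h
              rw [Fin.ext h] at h2
              have : (M.partner j).1 < j.1 := hp
              omega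
            omega
    · have hsum : (Finset.univ.filter fun i : Fin I.size => j.1 ≤ i.1 ∧ M.partner i < i) =
          Finset.univ.filter fun i : Fin I.size => j.1 + 1 ≤ i.1 ∧ M.partner i < i := by
        ext i
        simp only [Finset.mem_filter, Finset.mem_univ, true_and]
        constructor
        · rintro ⟨h1, h2⟩
          refine ⟨?_, h2⟩
          have : i.1 ≠ j.1 := by
            intro h
            rw [Fin.ext h] at h2
            exact lt_asymm hp h2
          omega
        · rintro ⟨h1, h2⟩
          exact ⟨by omega, h2⟩
      rw [hsum]
      refine Offline.wait _ _ _ _ _ ?_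
      rw [← Finset.image_insert]
      convert ih using 2
      · ext i
        simp only [Finset.mem_filter, Finset.mem_univ, true_and, Finset.mem_insert]
        have hp' : j.1 < (M.partner j).1 := hp
        constructor
        · rintro (rfl | ⟨h1, h2⟩)
          · exact ⟨by omega, hp⟩
          · refine ⟨by omega, ?_⟩
            have : (M.partner i).1 ≠ j.1 := by
              intro h
              have := congrArg Fin.val (hpp i (Fin.ext h))
              omega
            omega
        · rintro ⟨h1, h2⟩
          by_cases hij : i = j
          · exact Or.inl hij
          · have : i.1 ≠ j.1 := fun h => hij (Fin.ext h)
            exact Or.inr ⟨by omega, by omega⟩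

theorem PerfectMatching.sum_partner_lt (M : PerfectMatching I) (f : Fin I.size → Fin I.size → ℝ) :
    ∑ i with M.partner i < i, f (M.partner i) i = ∑ i with i < M.partner i, f i (M.partner i) := by
  refine Finset.sum_nbij' M.partner M.partner ?_ ?_ (fun i _ => M.partner_partner i)
    (fun i _ => M.partner_partner i) fun i _ => by rw [M.partner_partner]
  all_goals
    intro i hi
    simpa [M.partner_partner] using hi

theorem PerfectMatching.offline (M : PerfectMatching I) (T : Hierarchy S) :
    Offline V T ∅ I.requests.zipIdx (M.treeCost T) M.delayCost := by
  have h := M.offline_drop T I.size 0 rfl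
  simp only [not_lt_zero, false_and, Finset.filter_false, Finset.image_empty, List.drop_zero,
    zero_le, true_and] at h
  rw [M.sum_partner_lt fun i j => T.treeDist (I.req i).point (I.req j).point,
    M.sum_partner_lt fun i j => (I.req j).time - (I.req i).time] at h
  suffices hD : M.delayCost =
      ∑ i with i < M.partner i, ((I.req (M.partner i)).time - (I.req i).time) by
    rw [hD]
    exact h
  refine Finset.sum_congr rfl fun i hi => ?_
  have hi := (Finset.mem_filter.1 hi).2
  have hle : (I.req i).time ≤ (I.req (M.partner i)).time :=
    List.pairwise_iff_get.1 I.sorted _ _ hi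
  rw [abs_sub_comm, abs_of_nonneg (sub_nonneg.2 hle)]

/-- The algorithm on a tree is competitive: a constant factor for the connection cost and a factor
proportional to the height for the delay cost. -/
theorem onlineCost_treeAlgorithm_le [PseudoMetricSpace S] [Fintype L] (Ch : ChargeSystem.{u} V G)
    (T : Hierarchy S) (hT : ∀ p q, dist p q ≤ T.treeDist p q) {H : ℕ}
    (hH : ∀ p, (Finset.univ.filter fun u => p ∈ T.cluster u).card ≤ H) (M : PerfectMatching I) :
    ((treeAlgorithm Ch T).run I).onlineCost ≤ 5 * M.treeCost T + (5 * H + 1) * M.delayCost := by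
  have h := (treeOutput_run Ch T I).cost_le hT hH (initialState_consistent T I) (M.offline T)
    (by simp) (by simp [initialState])
  rw [← onlineCost_treeMatching] at h
  refine h.trans (le_of_eq ?_)
  simp [costBound, initialState, potential, totalCounter, counterPotential,
    ChargeSystem.surplus, Ch.excess_zero]

end

/-! ### Trees of logarithmic height from light clusters -/

section

section Clusters

variable {S : Type u} (cen : ℕ → S → S) (N : ℕ)

theorem Hierarchy.treeDist_comm (T : Hierarchy S) (p q : S) : T.treeDist p q = T.treeDist q p := by
  unfold Hierarchy.treeDist
  exact Finset.sum_congr rfl fun u _ => if_congr Iff.comm rfl rfl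

theorem Hierarchy.treeDist_nonneg (T : Hierarchy S) (p q : S) : 0 ≤ T.treeDist p q :=
  Finset.sum_nonneg fun u _ => by
    split_ifs
    exacts [le_rfl, T.weight_nonneg u]

/-- Two points are in the same cluster of level `i` if they have the same centre at every level
from `i` up to the top level `N`. -/
def SameCluster (i : ℕ) (p q : S) : Prop := ∀ j, i ≤ j → j ≤ N → cen j p = cen j q

variable {cen N}

/-- The highest level at which the centres of two points differ. -/
theorem exists_last_level (htop : ∀ p q, cen N p = cen N q) {p q : S}
    (h : ¬ SameCluster cen N 0 p q) :
    ∃ i < N, cen i p ≠ cen i q ∧ SameCluster cen N (i + 1) p q := by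
  have hne : ((Finset.range N).filter fun i => cen i p ≠ cen i q).Nonempty := by
    unfold SameCluster at h
    push Not at h
    obtain ⟨j, -, hj, hjne⟩ := h
    refine ⟨j, Finset.mem_filter.2 ⟨Finset.mem_range.2 (lt_of_le_of_ne hj ?_), hjne⟩⟩
    rintro rfl
    exact hjne (htop p q)
  obtain ⟨i, hi, hmax⟩ := Finset.exists_max_image _ id hne
  rw [Finset.mem_filter, Finset.mem_range] at hi
  refine ⟨i, hi.1, hi.2, fun j h1 h2 => ?_⟩
  by_contra hj
  rcases h2.lt_or_eq with h2 | rfl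
  · have := hmax j (Finset.mem_filter.2 ⟨Finset.mem_range.2 h2, hj⟩)
    simp only [id] at this
    omega
  · exact hj (htop p q)

variable {r : ℕ → ℝ}

theorem sum_range_succ_le_two_mul (h0 : ∀ i, 0 ≤ r i) (hr : ∀ i, 2 * r i ≤ r (i + 1)) (n : ℕ) :
    ∑ i ∈ Finset.range (n + 1), r i ≤ 2 * r n := by
  induction n with
  | zero => simpa using by linarith [h0 0]
  | succ n ih =>
    rw [Finset.sum_range_succ]
    linarith [hr n]

variable [Fintype S] (cen N)

/-- The cluster of level `i` around `p`. -/
def levelCluster (i : ℕ) (p : S) : Finset S := Finset.univ.filter fun q => SameCluster cen N i p q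

variable {cen N}

theorem mem_levelCluster {i : ℕ} {p q : S} :
    q ∈ levelCluster cen N i p ↔ SameCluster cen N i p q := by
  simp [levelCluster]

theorem self_mem_levelCluster (i : ℕ) (p : S) : p ∈ levelCluster cen N i p :=
  mem_levelCluster.2 fun _ _ _ => rfl

theorem levelCluster_congr {i : ℕ} {p q : S} (h : q ∈ levelCluster cen N i p) :
    levelCluster cen N i q = levelCluster cen N i p := by
  rw [mem_levelCluster] at h
  ext x
  rw [mem_levelCluster, mem_levelCluster]
  exact ⟨fun hx j h1 h2 => (h j h1 h2).trans (hx j h1 h2),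
    fun hx j h1 h2 => (h j h1 h2).symm.trans (hx j h1 h2)⟩

theorem levelCluster_mono {i j : ℕ} (hij : i ≤ j) (p : S) :
    levelCluster cen N i p ⊆ levelCluster cen N j p := fun q hq => by
  rw [mem_levelCluster] at hq ⊢
  exact fun k h1 h2 => hq k (hij.trans h1) h2

variable (cen N)

/-- A cluster is light if it has at most half of the points of its parent. -/
def Light (i : ℕ) (p : S) : Prop :=
  2 * (levelCluster cen N i p).card ≤ (levelCluster cen N (i + 1) p).card

/-- The hierarchy of light clusters. -/
def lightHierarchy (w : ℕ → ℝ) (hw : ∀ i, 0 ≤ w i) : Hierarchy S where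
  -- The level is recorded because the same set may be a cluster at several levels, with different
  -- weights.
  ι := {x : Fin N × Finset S // ∃ p, x.2 = levelCluster cen N x.1 p ∧ Light cen N x.1 p}
  cluster x := x.1.2
  weight x := w x.1.1
  weight_nonneg x := hw _
  laminar := by
    have key : ∀ i j p q, i ≤ j → levelCluster cen N i p ⊆ levelCluster cen N j q ∨
        Disjoint (levelCluster cen N i p) (levelCluster cen N j q) := by
      intro i j p q hij
      rw [or_iff_not_imp_right, Finset.not_disjoint_iff]
      rintro ⟨x, hx, hx'⟩
      rw [← levelCluster_congr hx, ← levelCluster_congr hx']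
      exact levelCluster_mono hij x
    rintro ⟨⟨i, A⟩, p, hA, -⟩ ⟨⟨j, B⟩, q, hB, -⟩
    dsimp only at hA hB ⊢
    rw [Finset.coe_subset, Finset.coe_subset, Finset.disjoint_coe, hA, hB]
    rcases le_total i.1 j.1 with h | h
    · rcases key _ _ p q h with h | h
      exacts [Or.inl h, Or.inr (Or.inr h)]
    · rcases key _ _ q p h with h | h
      exacts [Or.inr (Or.inl h), Or.inr (Or.inr h.symm)]

variable {cen N} {w : ℕ → ℝ} {hw : ∀ i, 0 ≤ w i}

theorem lightHierarchy_mem {p : S} {x : (lightHierarchy cen N w hw).ι}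
    (hx : p ∈ (lightHierarchy cen N w hw).cluster x) :
    x.1.2 = levelCluster cen N x.1.1 p ∧ Light cen N x.1.1 p := by
  obtain ⟨⟨i, A⟩, q, hA, hl⟩ := x
  dsimp only at hA hl ⊢
  have hx : p ∈ A := hx
  subst hA
  refine ⟨(levelCluster_congr hx).symm, ?_⟩
  unfold Light at hl ⊢
  rwa [levelCluster_congr hx, levelCluster_congr (levelCluster_mono (Nat.le_succ _) _ hx)]

theorem lightHierarchy_level_injOn (p : S) :
    Set.InjOn (fun x : (lightHierarchy cen N w hw).ι => x.1.1)
      {x | p ∈ (lightHierarchy cen N w hw).cluster x} := by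
  intro x hx y hy hxy
  have h1 := (lightHierarchy_mem hx).1
  have h2 := (lightHierarchy_mem hy).1
  have hxy : x.1.1 = y.1.1 := hxy
  rw [hxy] at h1
  exact Subtype.ext (Prod.ext hxy (h1.trans h2.symm))

theorem two_pow_card_le (f : ℕ → ℕ) (hf : Monotone f) (h0 : 1 ≤ f 0)
    (P : ℕ → Prop) (hP : ∀ i, P i → 2 * f i ≤ f (i + 1)) (n : ℕ) :
    2 ^ ((Finset.range n).filter P).card ≤ f n := by
  induction n with
  | zero => simpa using h0
  | succ n ih =>
    rw [Finset.range_add_one, Finset.filter_insert]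
    split_ifs with h
    · rw [Finset.card_insert_of_notMem (by simp), pow_succ]
      have := hP n h
      omega
    · exact ih.trans (hf (Nat.le_succ n))

/-- Passing from a light cluster to its parent at least doubles the size, so the number of light
levels around a point is bounded independently of `N`. -/
theorem lightHierarchy_depth (p : S) :
    (Finset.univ.filter fun x => p ∈ (lightHierarchy cen N w hw).cluster x).card ≤
      Nat.log 2 (Fintype.card S) := by
  have h1 : (Finset.univ.filter fun x => p ∈ (lightHierarchy cen N w hw).cluster x).card ≤
      ((Finset.range N).filter fun i => Light cen N i p).card := by
    refine Finset.card_le_card_of_injOn (fun x => x.1.1.1) ?_ ?_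
    · intro x hx
      have hx := (Finset.mem_filter.1 hx).2
      exact Finset.mem_coe.2 (Finset.mem_filter.2
        ⟨Finset.mem_range.2 x.1.1.2, (lightHierarchy_mem hx).2⟩)
    · intro x hx y hy hxy
      exact lightHierarchy_level_injOn p (Finset.mem_filter.1 hx).2 (Finset.mem_filter.1 hy).2
        (Fin.ext hxy)
  have h2 := two_pow_card_le (fun i => (levelCluster cen N i p).card)
    (fun i j hij => Finset.card_le_card (levelCluster_mono hij p))
    (Finset.card_pos.2 ⟨p, self_mem_levelCluster 0 p⟩) (fun i => Light cen N i p)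
    (fun _ hi => hi) N
  have hne : Fintype.card S ≠ 0 := (Fintype.card_pos_iff.2 ⟨p⟩).ne'
  exact h1.trans ((Nat.le_log_iff_pow_le one_lt_two hne).2 (le_trans h2 (Finset.card_le_univ _)))

theorem le_treeDist_of_light {i : ℕ} (hi : i < N) {p q : S} (hl : Light cen N i p)
    (hpq : ¬ SameCluster cen N i p q) : w i ≤ (lightHierarchy cen N w hw).treeDist p q := by
  set x : (lightHierarchy cen N w hw).ι := ⟨(⟨i, hi⟩, levelCluster cen N i p), p, rfl, hl⟩
  have hp : p ∈ (lightHierarchy cen N w hw).cluster x := self_mem_levelCluster i p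
  have hq : q ∉ (lightHierarchy cen N w hw).cluster x := fun h => hpq (mem_levelCluster.1 h)
  have := Finset.single_le_sum
    (f := fun u => if (p ∈ (lightHierarchy cen N w hw).cluster u ↔
      q ∈ (lightHierarchy cen N w hw).cluster u) then 0 else
      (lightHierarchy cen N w hw).weight u) (fun u _ => by
      split_ifs
      exacts [le_rfl, hw _]) (Finset.mem_univ x)
  simp only [hp, hq, iff_false, not_true_eq_false, if_false] at this
  exact this

/-- A separating cluster contains `p` or `q`, and each point has at most one cluster per level,
whence the factor `2`. -/
theorem treeDist_lightHierarchy_le (p q : S) :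
    (lightHierarchy cen N w hw).treeDist p q ≤
      2 * ∑ i ∈ Finset.range N, if SameCluster cen N i p q then 0 else w i := by
  set g : ℕ → ℝ := fun i => if SameCluster cen N i p q then 0 else w i with hg
  have hg0 : ∀ i, 0 ≤ g i := fun i => by
    simp only [hg]
    split_ifs
    exacts [le_rfl, hw i]
  have key : ∀ a : S, ∑ x : (lightHierarchy cen N w hw).ι with
      a ∈ (lightHierarchy cen N w hw).cluster x, g x.1.1 ≤ ∑ i ∈ Finset.range N, g i := by
    intro a
    rw [← Finset.sum_image (g := fun x : (lightHierarchy cen N w hw).ι => x.1.1.1) (f := g)]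
    · refine Finset.sum_le_sum_of_subset_of_nonneg ?_ fun i _ _ => hg0 i
      intro i hi
      obtain ⟨x, -, rfl⟩ := Finset.mem_image.1 hi
      exact Finset.mem_range.2 x.1.1.2
    · intro x hx y hy hxy
      exact lightHierarchy_level_injOn a (Finset.mem_filter.1 hx).2 (Finset.mem_filter.1 hy).2
        (Fin.ext hxy)
  have hle : (lightHierarchy cen N w hw).treeDist p q ≤
      ∑ x : (lightHierarchy cen N w hw).ι with p ∈ (lightHierarchy cen N w hw).cluster x, g x.1.1 +
      ∑ x : (lightHierarchy cen N w hw).ι with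
        q ∈ (lightHierarchy cen N w hw).cluster x, g x.1.1 := by
    rw [Finset.sum_filter, Finset.sum_filter, ← Finset.sum_add_distrib]
    refine Finset.sum_le_sum fun x _ => ?_
    have hsep : ∀ a b, a ∈ (lightHierarchy cen N w hw).cluster x →
        b ∉ (lightHierarchy cen N w hw).cluster x → ¬ SameCluster cen N x.1.1 a b := by
      intro a b ha hb hab
      have hb' : b ∉ x.1.2 := hb
      rw [(lightHierarchy_mem ha).1] at hb'
      exact hb' (mem_levelCluster.2 hab)
    by_cases hp : p ∈ (lightHierarchy cen N w hw).cluster x <;>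
      by_cases hq : q ∈ (lightHierarchy cen N w hw).cluster x
    · simp only [hp, hq, if_true]
      exact add_nonneg (hg0 _) (hg0 _)
    · simp only [hp, hq, iff_false, not_true_eq_false, if_false, if_true, add_zero]
      simp only [hg, hsep p q hp hq, if_false]
      exact le_rfl
    · simp only [hp, hq, iff_true, if_false, if_true, zero_add]
      have : ¬ SameCluster cen N x.1.1 p q := fun h =>
        hsep q p hq hp fun j h1 h2 => (h j h1 h2).symm
      simp only [hg, this, if_false]
      exact le_rfl
    · simp [hp, hq]
  have h1 := key p
  have h2 := key q
  linarith

/-- Only levels up to the highest level `k` with different centres contribute, and the doubling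
radii sum to at most `2 * r k`; so `24 = 2 * 6 * 2`. The single term `r k` of the right-hand sum
suffices. -/
theorem treeDist_lightHierarchy_le_sum_radius (h0 : ∀ i, 0 ≤ r i)
    (hr : ∀ i, 2 * r i ≤ r (i + 1)) (hw6 : ∀ i, w i = 6 * r i)
    (htop : ∀ p q, cen N p = cen N q) (p q : S) :
    (lightHierarchy cen N w hw).treeDist p q ≤
      24 * ∑ i ∈ Finset.range N, if cen i p = cen i q then 0 else r i := by
  refine (treeDist_lightHierarchy_le p q).trans ?_
  have hterm : ∀ i, 0 ≤ if cen i p = cen i q then 0 else r i := fun i => by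
    split_ifs
    exacts [le_rfl, h0 i]
  by_cases h : SameCluster cen N 0 p q
  · have hs : ∀ i, SameCluster cen N i p q := fun i j _ h2 => h j (Nat.zero_le _) h2
    rw [Finset.sum_eq_zero fun i _ => if_pos (hs i), mul_zero]
    exact mul_nonneg (by norm_num) (Finset.sum_nonneg fun i _ => hterm i)
  obtain ⟨k, hk, hne, hsame⟩ := exists_last_level htop h
  have h1 : r k ≤ ∑ i ∈ Finset.range N, if cen i p = cen i q then 0 else r i := by
    have := Finset.single_le_sum (f := fun i => if cen i p = cen i q then 0 else r i)
      (fun i _ => hterm i) (Finset.mem_range.2 hk)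
    simpa only [hne, if_false] using this
  have h2 : ∑ i ∈ Finset.range N, (if SameCluster cen N i p q then 0 else w i) ≤
      ∑ i ∈ Finset.range (k + 1), 6 * r i := by
    rw [← Finset.sum_filter_add_sum_filter_not (Finset.range N) fun i => i < k + 1]
    rw [Finset.sum_eq_zero (s := (Finset.range N).filter fun i => ¬ i < k + 1), add_zero]
    · have : (Finset.range N).filter (fun i => i < k + 1) = Finset.range (k + 1) := by
        ext i
        simp only [Finset.mem_filter, Finset.mem_range]
        omega
      rw [this]
      refine Finset.sum_le_sum fun i _ => ?_
      split_ifs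
      · linarith [h0 i]
      · exact (hw6 i).le
    · intro i hi
      have hi := (Finset.mem_filter.1 hi).2
      exact if_pos fun j h1 h2 => hsame j (by omega) h2
  have h3 := sum_range_succ_le_two_mul h0 hr k
  rw [← Finset.mul_sum] at h2
  linarith

/-- At the highest level `k` with different centres, the clusters of the two points are disjoint
inside one parent, so one of them is light. Its weight `6 * r k` is at least `2 * r (k + 1)`, which
bounds the distance. -/
theorem dist_le_treeDist_lightHierarchy [PseudoMetricSpace S]
    (hr : ∀ i, r (i + 1) ≤ 3 * r i) (hw6 : ∀ i, w i = 6 * r i)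
    (htop : ∀ p q, cen N p = cen N q) (hclose : ∀ i p q, cen i p = cen i q → dist p q ≤ 2 * r i)
    (hbot : ∀ p q, cen 0 p = cen 0 q → dist p q = 0) (p q : S) :
    dist p q ≤ (lightHierarchy cen N w hw).treeDist p q := by
  by_cases h : SameCluster cen N 0 p q
  · rw [hbot p q (h 0 le_rfl (Nat.zero_le _))]
    exact Hierarchy.treeDist_nonneg _ _ _
  obtain ⟨k, hk, hne, hsame⟩ := exists_last_level htop h
  have h1 : dist p q ≤ w k := by
    have := hclose (k + 1) p q (hsame _ le_rfl hk)
    have := hr k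
    have := hw6 k
    linarith
  have hns : ¬ SameCluster cen N k p q := fun h' => hne (h' k le_rfl hk.le)
  refine h1.trans ?_
  by_cases hp : Light cen N k p
  · exact le_treeDist_of_light hk hp hns
  by_cases hq : Light cen N k q
  · rw [Hierarchy.treeDist_comm]
    exact le_treeDist_of_light hk hq fun h' => hns fun j h1 h2 => (h' j h1 h2).symm
  exfalso
  unfold Light at hp hq
  have hmem : q ∈ levelCluster cen N (k + 1) p := mem_levelCluster.2 hsame
  rw [levelCluster_congr hmem] at hq
  have hdis : Disjoint (levelCluster cen N k p) (levelCluster cen N k q) := by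
    rw [Finset.disjoint_left]
    intro x hx hx'
    refine hns (mem_levelCluster.1 ?_)
    rw [← levelCluster_congr hx, levelCluster_congr hx']
    exact self_mem_levelCluster k q
  have hsub : levelCluster cen N k p ∪ levelCluster cen N k q ⊆ levelCluster cen N (k + 1) p := by
    refine Finset.union_subset (levelCluster_mono (Nat.le_succ _) _) ?_
    rw [← levelCluster_congr hmem]
    exact levelCluster_mono (Nat.le_succ _) _
  have := Finset.card_le_card hsub
  rw [Finset.card_union_of_disjoint hdis] at this
  omega

end Clusters

end

/-! ### Random orders, geometric radii and centres -/

section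

section Counting

/-- Under at most a fraction of `1 / |W|` of the permutations, a given element of `W` comes before
all others. -/
theorem card_perm_first_mul_card_le {n : ℕ} (W : Finset (Fin n)) (a : Fin n) (ha : a ∈ W) :
    (Finset.univ.filter fun π : Equiv.Perm (Fin n) => ∀ b ∈ W, π a ≤ π b).card * W.card ≤
      Fintype.card (Equiv.Perm (Fin n)) := by
  set E : Fin n → Finset (Equiv.Perm (Fin n)) := fun a =>
    Finset.univ.filter fun π => ∀ b ∈ W, π a ≤ π b with hE
  -- Exchanging the values at `a` and `b` maps one event into the other.
  have hle : ∀ b ∈ W, (E a).card ≤ (E b).card := by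
    intro b hb
    refine Finset.card_le_card_of_injOn (fun π => π * Equiv.swap a b) ?_
      fun _ _ _ _ h => mul_right_cancel h
    intro π hπ
    have hπ := (Finset.mem_filter.1 hπ).2
    refine Finset.mem_coe.2 (Finset.mem_filter.2 ⟨Finset.mem_univ _, fun c hc => ?_⟩)
    rw [Equiv.Perm.mul_apply, Equiv.Perm.mul_apply, Equiv.swap_apply_right]
    refine hπ _ ?_
    rw [Equiv.swap_apply_def]
    split_ifs
    exacts [hb, ha, hc]
  have hdis : (W : Set (Fin n)).PairwiseDisjoint E := by
    intro b hb c hc hbc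
    refine Finset.disjoint_left.2 fun π h1 h2 => hbc ?_
    have h1 := (Finset.mem_filter.1 h1).2 c hc
    have h2 := (Finset.mem_filter.1 h2).2 b hb
    exact π.injective (le_antisymm h1 h2)
  calc (E a).card * W.card = ∑ b ∈ W, (E a).card := by
        rw [Finset.sum_const, smul_eq_mul, mul_comm]
    _ ≤ ∑ b ∈ W, (E b).card := Finset.sum_le_sum hle
    _ = (W.biUnion E).card := (Finset.card_biUnion hdis).symm
    _ ≤ _ := Finset.card_le_univ _

/-- A point with the largest `m` counts the whole set and contributes the last harmonic term;
removing it can only lower the other counts. -/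
theorem sum_inv_card_le_harmonic {α : Type*} (m : α → ℝ) (X : Finset α) :
    ∑ w ∈ X, ((X.filter fun x => m x ≤ m w).card : ℝ)⁻¹ ≤ harmonic X.card := by
  induction X using Finset.induction_on_max_value m with
  | empty => simp
  | insert a X ha hmax ih =>
    rw [Finset.sum_insert ha, Finset.card_insert_of_notMem ha, harmonic_succ, add_comm]
    push_cast
    refine add_le_add (le_trans (Finset.sum_le_sum fun w hw => ?_) ih) (le_of_eq ?_)
    · have hpos : 0 < (X.filter fun x => m x ≤ m w).card :=
        Finset.card_pos.2 ⟨w, Finset.mem_filter.2 ⟨hw, le_rfl⟩⟩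
      refine inv_anti₀ (by exact_mod_cast hpos) ?_
      exact_mod_cast Finset.card_le_card
        (Finset.filter_subset_filter _ (Finset.subset_insert a X))
    · rw [Finset.filter_true_of_mem, Finset.card_insert_of_notMem ha]
      · push_cast
        rfl
      · intro x hx
        rcases Finset.mem_insert.1 hx with rfl | hx
        exacts [le_rfl, hmax x hx]

/-- The steps of a geometric sequence that start in `[a, b)` have total length at most `γ b - a`. -/
theorem sum_steps_le {γ : ℝ} (hγ : 1 ≤ γ) {ρ : ℕ → ℝ} (hmono : Monotone ρ)
    (hρ : ∀ k, ρ (k + 1) = γ * ρ k) {a b : ℝ} (hab : a ≤ b) (hb : 0 ≤ b) (K : ℕ) :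
    ∑ k ∈ Finset.range K, (if a ≤ ρ k ∧ ρ k < b then ρ (k + 1) - ρ k else 0) ≤ γ * b - a := by
  -- Clamping to `[a, γ b]` makes the sum telescope: a step that starts below `b` ends at most at `γ
  -- b`.
  set g : ℝ → ℝ := fun x => max a (min x (γ * b)) with hg
  have hbγ : b ≤ γ * b := le_mul_of_one_le_left hb hγ
  have hgm : Monotone g := fun x y h => max_le_max le_rfl (min_le_min h le_rfl)
  have hterm : ∀ k, (if a ≤ ρ k ∧ ρ k < b then ρ (k + 1) - ρ k else 0) ≤
      g (ρ (k + 1)) - g (ρ k) := by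
    intro k
    have hk := hmono (Nat.le_succ k)
    split_ifs with h
    · have h1 : ρ (k + 1) ≤ γ * b := by
        rw [hρ]
        exact mul_le_mul_of_nonneg_left h.2.le (by linarith)
      simp only [hg]
      rw [min_eq_left h1, min_eq_left (h.2.le.trans hbγ), max_eq_right h.1,
        max_eq_right (h.1.trans hk)]
    · exact sub_nonneg.2 (hgm hk)
  refine (Finset.sum_le_sum fun k _ => hterm k).trans ?_
  rw [Finset.sum_range_sub fun k => g (ρ k)]
  have h1 : g (ρ K) ≤ γ * b := max_le (hab.trans hbγ) (min_le_right _ _)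
  have h2 : a ≤ g (ρ 0) := le_max_left _ _
  linarith

theorem sum_range_mul_eq (f : ℕ → ℝ) (M N : ℕ) :
    ∑ k ∈ Finset.range (M * N), f k =
      ∑ i ∈ Finset.range M, ∑ j ∈ Finset.range N, f (i * N + j) := by
  induction M with
  | zero => simp
  | succ M ih => rw [Nat.succ_mul, Finset.sum_range_add, ih, Finset.sum_range_succ]

end Counting

section Centre

variable {S : Type u} [Fintype S] [PseudoMetricSpace S] {n : ℕ}

theorem exists_centre (rank : S → Fin n) {r : ℝ} (hr : 0 ≤ r) (p : S) :
    ∃ w, dist p w ≤ r ∧ ∀ x, dist p x ≤ r → rank w ≤ rank x := by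
  obtain ⟨w, hw, hmin⟩ := (Finset.univ.filter fun w => dist p w ≤ r).exists_min_image rank
    ⟨p, by simpa using hr⟩
  exact ⟨w, (Finset.mem_filter.1 hw).2, fun x hx =>
    hmin x (Finset.mem_filter.2 ⟨Finset.mem_univ _, hx⟩)⟩

/-- The first point, in order of rank, within distance `r`. -/
def centre (rank : S → Fin n) (r : ℝ) (p : S) : S :=
  if hr : 0 ≤ r then (exists_centre rank hr p).choose else p

variable {rank : S → Fin n} {r : ℝ}

theorem dist_centre_le (hr : 0 ≤ r) (p : S) : dist p (centre rank r p) ≤ r := by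
  rw [centre, dif_pos hr]
  exact (exists_centre rank hr p).choose_spec.1

theorem rank_centre_le (hr : 0 ≤ r) {p x : S} (hx : dist p x ≤ r) :
    rank (centre rank r p) ≤ rank x := by
  rw [centre, dif_pos hr]
  exact (exists_centre rank hr p).choose_spec.2 x hx

/-- If two points have different centres, then their separation is due to a single point that
comes first among all points as close to the pair. -/
theorem exists_separating_of_centre_ne (hrank : Function.Injective rank) (hr : 0 ≤ r) {p q : S}
    (h : centre rank r p ≠ centre rank r q) :
    ∃ w, (min (dist p w) (dist q w) ≤ r ∧ r < max (dist p w) (dist q w)) ∧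
      ∀ x, min (dist p x) (dist q x) ≤ min (dist p w) (dist q w) → rank w ≤ rank x := by
  have key : ∀ a b, rank (centre rank r a) < rank (centre rank r b) →
      ∃ w, (min (dist a w) (dist b w) ≤ r ∧ r < max (dist a w) (dist b w)) ∧
      ∀ x, min (dist a x) (dist b x) ≤ min (dist a w) (dist b w) → rank w ≤ rank x := by
    intro a b hlt
    have hmin := (min_le_left (dist a (centre rank r a)) (dist b (centre rank r a))).trans
      (dist_centre_le (rank := rank) hr a)
    -- The better-ranked centre is out of reach of the other point, which would otherwise have a
    -- centre at least as good.
    refine ⟨centre rank r a, ⟨hmin, lt_max_of_lt_right ?_⟩, fun x hx => ?_⟩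
    · by_contra hc
      exact absurd (rank_centre_le hr (not_lt.1 hc)) (not_le.2 hlt)
    · rcases min_le_iff.1 (hx.trans hmin) with hx | hx
      · exact rank_centre_le hr hx
      · exact hlt.le.trans (rank_centre_le hr hx)
  rcases lt_or_gt_of_ne fun h' => h (hrank h') with hlt | hlt
  · exact key p q hlt
  · obtain ⟨w, h1, h2⟩ := key q p hlt
    refine ⟨w, by rwa [min_comm, max_comm], fun x hx => h2 x ?_⟩
    rwa [min_comm (dist q x), min_comm (dist q w)]

theorem centre_eq_of_forall_dist_le (hrank : Function.Injective rank) (hr : 0 ≤ r)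
    (h : ∀ p q : S, dist p q ≤ r) (p q : S) : centre rank r p = centre rank r q :=
  hrank (le_antisymm (rank_centre_le hr (h _ _)) (rank_centre_le hr (h _ _)))

theorem dist_le_of_centre_eq (hr : 0 ≤ r) {p q : S} (h : centre rank r p = centre rank r q) :
    dist p q ≤ 2 * r := by
  have h1 := dist_centre_le (rank := rank) hr p
  have h2 := dist_centre_le (rank := rank) hr q
  rw [← h, dist_comm] at h2
  linarith [dist_triangle p (centre rank r p) q]

end Centre

end

/-! ### The random tree embedding -/

section

theorem exists_pos_le_dist (S : Type u) [Fintype S] [PseudoMetricSpace S] :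
    ∃ δ : ℝ, 0 < δ ∧ ∀ p q : S, 0 < dist p q → δ ≤ dist p q := by
  rcases (Finset.univ.filter fun x : S × S => 0 < dist x.1 x.2).eq_empty_or_nonempty with h | h
  · refine ⟨1, one_pos, fun p q hpq => ?_⟩
    exact absurd hpq (Finset.filter_eq_empty_iff.1 h (Finset.mem_univ (p, q)))
  · obtain ⟨x, hx, hmin⟩ := Finset.exists_min_image _ (fun x : S × S => dist x.1 x.2) h
    exact ⟨_, (Finset.mem_filter.1 hx).2, fun p q hpq =>
      hmin (p, q) (Finset.mem_filter.2 ⟨Finset.mem_univ _, hpq⟩)⟩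

theorem exists_dist_le (S : Type u) [Fintype S] [PseudoMetricSpace S] :
    ∃ D : ℝ, 0 ≤ D ∧ ∀ p q : S, dist p q ≤ D :=
  ⟨∑ x : S × S, dist x.1 x.2, Finset.sum_nonneg fun _ _ => dist_nonneg, fun p q =>
    Finset.single_le_sum (f := fun x : S × S => dist x.1 x.2) (fun _ _ => dist_nonneg)
      (Finset.mem_univ (p, q))⟩

section Expectation

variable {S : Type u} [PseudoMetricSpace S] {n N : ℕ}

/-- The radii at which a single point separates `p` and `q` contribute little. -/
theorem sum_separating_radii_le (hN : 0 < N) {D δ : ℝ} (hD : ∀ p q : S, dist p q ≤ D)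
    (hδ : ∀ p q : S, 0 < dist p q → δ ≤ dist p q) (hDN : D ≤ N * δ) {ρ : ℕ → ℝ}
    (hρ0 : ∀ k, 0 ≤ ρ k) (hρ : ∀ k, ρ (k + 1) = (1 + 1 / N) * ρ k) (M : ℕ) (p q w : S) :
    ∑ i ∈ Finset.range M, ∑ j ∈ Finset.range N,
      (if min (dist p w) (dist q w) ≤ ρ (i * N + j) ∧
          ρ (i * N + j) < max (dist p w) (dist q w) then ρ (i * N + j) else 0) ≤
      N * (2 * dist p q) := by
  have hN' : (0 : ℝ) < N := by exact_mod_cast hN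
  rw [← sum_range_mul_eq (fun k => if min (dist p w) (dist q w) ≤ ρ k ∧
    ρ k < max (dist p w) (dist q w) then ρ k else 0)]
  have hdiff : max (dist p w) (dist q w) - min (dist p w) (dist q w) ≤ dist p q := by
    rw [max_sub_min_eq_abs, abs_sub_comm]
    exact abs_dist_sub_le p q w
  rcases dist_nonneg (x := p) (y := q) |>.eq_or_lt with h0 | h0
  · rw [← h0] at hdiff ⊢
    rw [Finset.sum_eq_zero fun k _ => if_neg fun h => by linarith [h.1, h.2]]
    simp
  -- The ratio `1 + 1 / N` makes every radius `N` times the following step.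
  have hstep : ∀ k, ρ k = N * (ρ (k + 1) - ρ k) := by
    intro k
    rw [hρ]
    field_simp
    ring
  have hγ : (1 : ℝ) ≤ 1 + 1 / N := le_add_of_nonneg_right (by positivity)
  have hmono : Monotone ρ := monotone_nat_of_le_succ fun k => by
    rw [hρ]
    exact le_mul_of_one_le_left (hρ0 k) hγ
  have hs := sum_steps_le hγ hmono hρ (min_le_max (a := dist p w) (b := dist q w))
    (le_max_of_le_left dist_nonneg) (M * N)
  have heq : ∑ k ∈ Finset.range (M * N), (if min (dist p w) (dist q w) ≤ ρ k ∧
      ρ k < max (dist p w) (dist q w) then ρ k else 0) =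
      N * ∑ k ∈ Finset.range (M * N), (if min (dist p w) (dist q w) ≤ ρ k ∧
      ρ k < max (dist p w) (dist q w) then ρ (k + 1) - ρ k else 0) := by
    rw [Finset.mul_sum]
    refine Finset.sum_congr rfl fun k _ => ?_
    split_ifs
    exacts [hstep k, (mul_zero _).symm]
  rw [heq]
  refine mul_le_mul_of_nonneg_left (hs.trans ?_) hN'.le
  -- The overshoot `b / N` is at most `D / N ≤ δ ≤ dist p q`. This is why `N` has to bound the
  -- aspect ratio.
  have h1 : 1 / (N : ℝ) * max (dist p w) (dist q w) ≤ dist p q := by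
    have h2 : max (dist p w) (dist q w) ≤ N * dist p q :=
      (max_le (hD _ _) (hD _ _)).trans (hDN.trans (mul_le_mul_of_nonneg_left (hδ p q h0) hN'.le))
    rw [one_div, inv_mul_le_iff₀ hN']
    exact h2
  linarith

variable [Fintype S]

/-- The expected radius at which the centres of two points differ. -/
theorem sum_centre_ne_le (e : S ≃ Fin n) (hN : 0 < N) {D δ : ℝ} (hD : ∀ p q : S, dist p q ≤ D)
    (hδ : ∀ p q : S, 0 < dist p q → δ ≤ dist p q) (hDN : D ≤ N * δ) {ρ : ℕ → ℝ}
    (hρ0 : ∀ k, 0 ≤ ρ k) (hρ : ∀ k, ρ (k + 1) = (1 + 1 / N) * ρ k) (M : ℕ) (p q : S) :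
    ∑ π : Equiv.Perm (Fin n), ∑ j : Fin N, ∑ i ∈ Finset.range M,
      (if centre (fun x => π (e x)) (ρ (i * N + j)) p = centre (fun x => π (e x)) (ρ (i * N + j)) q
        then 0 else ρ (i * N + j)) ≤
      Fintype.card (Equiv.Perm (Fin n)) * N * (2 * harmonic n * dist p q) := by
  set m : S → ℝ := fun w => min (dist p w) (dist q w) with hm
  -- `F` depends only on the order and `R` only on the radius, so the average factorises for each
  -- separating point `w`.
  set F : Equiv.Perm (Fin n) → S → ℝ := fun π w =>
    if ∀ x, m x ≤ m w → π (e w) ≤ π (e x) then 1 else 0 with hF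
  set R : S → ℕ → ℝ := fun w k =>
    if m w ≤ ρ k ∧ ρ k < max (dist p w) (dist q w) then ρ k else 0 with hR
  have hF0 : ∀ π w, 0 ≤ F π w := fun π w => by
    simp only [hF]
    split_ifs <;> norm_num
  have hR0 : ∀ w k, 0 ≤ R w k := fun w k => by
    simp only [hR]
    split_ifs
    exacts [hρ0 k, le_rfl]
  have hpoint : ∀ (π : Equiv.Perm (Fin n)) k,
      (if centre (fun x => π (e x)) (ρ k) p = centre (fun x => π (e x)) (ρ k) q
        then 0 else ρ k) ≤ ∑ w, F π w * R w k := by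
    intro π k
    have hnn : ∀ w ∈ Finset.univ, 0 ≤ F π w * R w k := fun w _ => mul_nonneg (hF0 _ _) (hR0 _ _)
    split_ifs with h
    · exact Finset.sum_nonneg hnn
    · obtain ⟨w, h1, h2⟩ := exists_separating_of_centre_ne
        (rank := fun x => π (e x)) (π.injective.comp e.injective) (hρ0 k) h
      have hFw : F π w = 1 := if_pos h2
      have hRw : R w k = ρ k := if_pos h1
      have := Finset.single_le_sum hnn (Finset.mem_univ w)
      rwa [hFw, hRw, one_mul] at this
  have hcard : ∀ w, ∑ π, F π w ≤ Fintype.card (Equiv.Perm (Fin n)) *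
      ((Finset.univ.filter fun x => m x ≤ m w).card : ℝ)⁻¹ := by
    intro w
    have hpos : (0 : ℝ) < (Finset.univ.filter fun x => m x ≤ m w).card :=
      Nat.cast_pos.2 (Finset.card_pos.2 ⟨w, Finset.mem_filter.2 ⟨Finset.mem_univ _, le_rfl⟩⟩)
    rw [← div_eq_mul_inv, le_div_iff₀ hpos]
    have h1 := card_perm_first_mul_card_le
      ((Finset.univ.filter fun x => m x ≤ m w).map e.toEmbedding) (e w)
      (Finset.mem_map_of_mem _ (Finset.mem_filter.2 ⟨Finset.mem_univ _, le_rfl⟩))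
    rw [Finset.card_map] at h1
    simp only [hF, Finset.sum_boole]
    have h2 : (Finset.univ.filter fun π : Equiv.Perm (Fin n) =>
        ∀ x, m x ≤ m w → π (e w) ≤ π (e x)).card ≤ (Finset.univ.filter fun π : Equiv.Perm (Fin n) =>
        ∀ b ∈ (Finset.univ.filter fun x => m x ≤ m w).map e.toEmbedding, π (e w) ≤ π b).card := by
      refine Finset.card_le_card fun π hπ => ?_
      rw [Finset.mem_filter] at hπ ⊢
      refine ⟨hπ.1, fun b hb => ?_⟩
      obtain ⟨x, hx, rfl⟩ := Finset.mem_map.1 hb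
      exact hπ.2 x (Finset.mem_filter.1 hx).2
    exact_mod_cast (Nat.mul_le_mul_right _ h2).trans h1
  have hrad : ∀ w, ∑ j : Fin N, ∑ i ∈ Finset.range M, R w (i * N + j) ≤ N * (2 * dist p q) := by
    intro w
    rw [Finset.sum_comm]
    refine le_trans (le_of_eq (Finset.sum_congr rfl fun i _ => ?_))
      (sum_separating_radii_le hN hD hδ hDN hρ0 hρ M p q w)
    rw [Finset.sum_range fun j => R w (i * N + j)]
  have hS : Fintype.card S = n := by rw [Fintype.card_congr e, Fintype.card_fin]
  have hharm : ∑ w, ((Finset.univ.filter fun x => m x ≤ m w).card : ℝ)⁻¹ ≤ harmonic n := by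
    have := sum_inv_card_le_harmonic m Finset.univ
    rwa [Finset.card_univ, hS] at this
  calc ∑ π : Equiv.Perm (Fin n), ∑ j : Fin N, ∑ i ∈ Finset.range M,
      (if centre (fun x => π (e x)) (ρ (i * N + j)) p = centre (fun x => π (e x)) (ρ (i * N + j)) q
        then 0 else ρ (i * N + j))
      ≤ ∑ π : Equiv.Perm (Fin n), ∑ j : Fin N, ∑ i ∈ Finset.range M,
        ∑ w, F π w * R w (i * N + j) :=
        Finset.sum_le_sum fun π _ => Finset.sum_le_sum fun j _ => Finset.sum_le_sum fun i _ =>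
          hpoint π _
    _ = ∑ w, (∑ π, F π w) * ∑ j : Fin N, ∑ i ∈ Finset.range M, R w (i * N + j) := by
        have hin : ∀ π, ∑ j : Fin N, ∑ i ∈ Finset.range M, ∑ w, F π w * R w (i * N + j) =
            ∑ w, F π w * ∑ j : Fin N, ∑ i ∈ Finset.range M, R w (i * N + j) := by
          intro π
          simp only [Finset.mul_sum]
          exact ((Finset.sum_comm).trans (Finset.sum_congr rfl fun j _ => Finset.sum_comm)).symm
        rw [Finset.sum_congr rfl fun π _ => hin π, Finset.sum_comm]
        exact Finset.sum_congr rfl fun w _ => (Finset.sum_mul _ _ _).symm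
    _ ≤ ∑ w, (Fintype.card (Equiv.Perm (Fin n)) *
          ((Finset.univ.filter fun x => m x ≤ m w).card : ℝ)⁻¹) * (N * (2 * dist p q)) := by
        refine Finset.sum_le_sum fun w _ => mul_le_mul (hcard w) (hrad w) ?_ (by positivity)
        exact Finset.sum_nonneg fun j _ => Finset.sum_nonneg fun i _ => hR0 _ _
    _ = Fintype.card (Equiv.Perm (Fin n)) * N * (2 * dist p q) *
          ∑ w, ((Finset.univ.filter fun x => m x ≤ m w).card : ℝ)⁻¹ := by
        rw [Finset.mul_sum]
        exact Finset.sum_congr rfl fun w _ => by ring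
    _ ≤ Fintype.card (Equiv.Perm (Fin n)) * N * (2 * dist p q) * harmonic n :=
        mul_le_mul_of_nonneg_left hharm (by positivity)
    _ = _ := by ring

end Expectation

/-- A finite metric space embeds into a random tree of logarithmic height, with logarithmic
expected distortion. -/
theorem exists_random_hierarchy (S : Type u) [Fintype S] [PseudoMetricSpace S] :
    ∃ (Ω : Type) (_ : Fintype Ω) (_ : Nonempty Ω) (T : Ω → Hierarchy S),
      (∀ ω p q, dist p q ≤ (T ω).treeDist p q) ∧
      (∀ ω p, (Finset.univ.filter fun u => p ∈ (T ω).cluster u).card ≤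
        Nat.log 2 (Fintype.card S)) ∧
      ∀ p q, ∑ ω, (T ω).treeDist p q ≤
        Fintype.card Ω * (48 * harmonic (Fintype.card S) * dist p q) := by
  obtain ⟨δ, hδ0, hδ⟩ := exists_pos_le_dist S
  obtain ⟨D, hD0, hD⟩ := exists_dist_le S
  obtain ⟨N, hN⟩ : ∃ N : ℕ, 0 < N ∧ D ≤ N * δ := by
    obtain ⟨N, hN⟩ := exists_nat_ge (D / δ)
    refine ⟨N + 1, Nat.succ_pos _, ?_⟩
    rw [div_le_iff₀ hδ0] at hN
    push_cast
    linarith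
  obtain ⟨hN, hDN⟩ := hN
  have hN' : (0 : ℝ) < N := by exact_mod_cast hN
  -- The `N` shifts of one geometric sequence serve as a discrete random scale. Consecutive levels
  -- differ by `γ ^ N`, between `2` (Bernoulli) and `exp 1 < 3`.
  set γ : ℝ := 1 + 1 / N with hγ
  have hγ1 : 1 ≤ γ := le_add_of_nonneg_right (by positivity)
  have hγ2 : 2 ≤ γ ^ N := by
    have := one_add_mul_le_pow (a := 1 / (N : ℝ)) (by
      have : (0 : ℝ) ≤ 1 / N := by positivity
      linarith) N
    rw [mul_one_div_cancel hN'.ne'] at this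
    linarith
  have hγ3 : γ ^ N ≤ 3 := by
    have h1 : γ ≤ Real.exp (1 / N) := by
      rw [hγ, add_comm]
      exact Real.add_one_le_exp _
    have h2 := pow_le_pow_left₀ (by linarith) h1 N
    rw [← Real.exp_nat_mul, mul_one_div_cancel hN'.ne'] at h2
    exact h2.trans Real.exp_one_lt_three.le
  -- With `δ / 8`, points sharing a bottom centre are within `2 * 3 * δ / 8 < δ`, hence at distance
  -- `0`.
  set ρ : ℕ → ℝ := fun k => δ / 8 * γ ^ k with hρ
  have hρ0 : ∀ k, 0 ≤ ρ k := fun k => by positivity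
  have hρs : ∀ k, ρ (k + 1) = γ * ρ k := fun k => by
    simp only [hρ, pow_succ]
    ring
  have hρN : ∀ i j, ρ ((i + 1) * N + j) = γ ^ N * ρ (i * N + j) := fun i j => by
    simp only [hρ]
    rw [Nat.succ_mul, add_right_comm, pow_add _ _ N]
    ring
  obtain ⟨M, hM⟩ : ∃ M : ℕ, D ≤ δ / 8 * 2 ^ M := by
    obtain ⟨M, hM⟩ := pow_unbounded_of_one_lt (D / (δ / 8)) (one_lt_two (α := ℝ))
    refine ⟨M, ?_⟩
    rw [div_lt_iff₀ (by positivity)] at hM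
    linarith
  have htop : ∀ j, D ≤ ρ (M * N + j) := fun j => by
    refine hM.trans ?_
    simp only [hρ]
    refine mul_le_mul_of_nonneg_left ?_ (by positivity)
    calc (2 : ℝ) ^ M ≤ (γ ^ N) ^ M := pow_le_pow_left₀ zero_le_two hγ2 M
      _ = γ ^ (M * N) := by rw [← pow_mul, mul_comm]
      _ ≤ γ ^ (M * N + j) := pow_le_pow_right₀ hγ1 (Nat.le_add_right _ _)
  have hbot : ∀ j : Fin N, 2 * ρ (0 * N + j) < δ := fun j => by
    have h1 : γ ^ (0 * N + j.1) ≤ γ ^ N := pow_le_pow_right₀ hγ1 (by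
      have := j.2
      omega)
    simp only [hρ]
    nlinarith
  set n := Fintype.card S with hn
  set e : S ≃ Fin n := Fintype.equivFin S with he
  set T : Equiv.Perm (Fin n) × Fin N → Hierarchy S := fun ω =>
    lightHierarchy (fun i => centre (fun x => ω.1 (e x)) (ρ (i * N + ω.2))) M
      (fun i => 6 * ρ (i * N + ω.2)) fun i => mul_nonneg (by norm_num) (hρ0 _) with hT
  have hinj : ∀ π : Equiv.Perm (Fin n), Function.Injective fun x => π (e x) := fun π =>
    π.injective.comp e.injective
  have htop' : ∀ (ω : Equiv.Perm (Fin n) × Fin N) (p q : S),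
      centre (fun x => ω.1 (e x)) (ρ (M * N + ω.2)) p =
        centre (fun x => ω.1 (e x)) (ρ (M * N + ω.2)) q := fun ω =>
    centre_eq_of_forall_dist_le (hinj ω.1) (hρ0 _) fun p q => (hD p q).trans (htop _)
  refine ⟨Equiv.Perm (Fin n) × Fin N, inferInstance, ⟨1, ⟨0, hN⟩⟩, T, fun ω p q => ?_,
    fun ω p => lightHierarchy_depth p, fun p q => ?_⟩
  · refine dist_le_treeDist_lightHierarchy (r := fun i => ρ (i * N + ω.2)) (fun i => ?_)
      (fun i => rfl) (htop' ω) (fun i p q h => dist_le_of_centre_eq (hρ0 _) h) (fun p q h => ?_) p q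
    · rw [hρN]
      exact mul_le_mul_of_nonneg_right hγ3 (hρ0 _)
    · by_contra hne
      have h1 := hδ p q (lt_of_le_of_ne dist_nonneg (Ne.symm hne))
      have h2 := dist_le_of_centre_eq (hρ0 _) h
      have h3 := hbot ω.2
      linarith
  · have h1 : ∀ ω, (T ω).treeDist p q ≤ 24 * ∑ i ∈ Finset.range M,
        if centre (fun x => ω.1 (e x)) (ρ (i * N + ω.2)) p =
          centre (fun x => ω.1 (e x)) (ρ (i * N + ω.2)) q then 0 else ρ (i * N + ω.2) := by
      intro ω
      refine treeDist_lightHierarchy_le_sum_radius (r := fun i => ρ (i * N + ω.2))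
        (fun i => hρ0 _) (fun i => ?_) (fun i => rfl) (htop' ω) p q
      rw [hρN]
      exact mul_le_mul_of_nonneg_right hγ2 (hρ0 _)
    have h2 := sum_centre_ne_le e hN hD hδ hDN hρ0 hρs M p q
    refine (Finset.sum_le_sum fun ω _ => h1 ω).trans ?_
    rw [← Finset.mul_sum, Fintype.sum_prod_type, Fintype.card_prod, Fintype.card_fin]
    push_cast
    linarith

end


/-! ### Averaging over the random tree -/

theorem exists_competitive {L G : Type} [Fintype L] [AddCommGroup G] {V : Variant L}
    (Ch : ChargeSystem.{u} V G) (S : Type u) [Fintype S] [PseudoMetricSpace S]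
    (hS : 2 ≤ Fintype.card S) :
    ∃ A : RandomizedAlgorithm V S, A.IsCompetitive (600 * Real.log (Fintype.card S)) := by
  obtain ⟨Ω, _, _, T, hdist, hdepth, hexp⟩ := exists_random_hierarchy S
  let _ : MeasurableSpace Ω := ⊤
  have hcard : (0 : ℝ) < Fintype.card Ω := by exact_mod_cast Fintype.card_pos
  refine ⟨⟨Ω, (PMF.uniformOfFintype Ω).toMeasure, fun ω => treeAlgorithm Ch (T ω),
    fun _ _ _ => MeasurableSpace.measurableSet_top, fun _ _ => measurable_from_top⟩,
    fun I => ⟨Integrable.of_finite, fun M => ?_⟩⟩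
  change ∫ ω, ((treeAlgorithm Ch (T ω)).run I).onlineCost ∂(PMF.uniformOfFintype Ω).toMeasure ≤ _
  rw [PMF.integral_eq_sum]
  simp only [PMF.uniformOfFintype_apply, ENNReal.toReal_inv, ENNReal.toReal_natCast, smul_eq_mul]
  rw [← Finset.mul_sum, inv_mul_le_iff₀ hcard]
  have hconn : ∑ ω, M.treeCost (T ω) ≤
      Fintype.card Ω * (48 * harmonic (Fintype.card S) * M.connectionCost) := by
    unfold PerfectMatching.treeCost PerfectMatching.connectionCost
    rw [Finset.sum_comm, Finset.mul_sum, Finset.mul_sum]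
    exact Finset.sum_le_sum fun i _ => hexp _ _
  have hsum := Finset.sum_le_sum fun ω (_ : ω ∈ Finset.univ) =>
    onlineCost_treeAlgorithm_le Ch (T ω) (hdist ω) (hdepth ω) M
  rw [Finset.sum_add_distrib, ← Finset.mul_sum, Finset.sum_const, Finset.card_univ,
    nsmul_eq_mul] at hsum
  have hc0 : 0 ≤ M.connectionCost := Finset.sum_nonneg fun _ _ => dist_nonneg
  have hd0 : 0 ≤ M.delayCost := Finset.sum_nonneg fun _ _ => abs_nonneg _
  set l := Real.log (Fintype.card S) with hl
  have hlog2 := Real.log_two_gt_d9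
  have hl2 : Real.log 2 ≤ l := Real.log_le_log two_pos (by exact_mod_cast hS)
  -- Since `log 2 > 2 / 3`, the constant `1` is at most `3 / 2 * l`. The connection cost then gets
  -- the factor `5 * 48 * (5 / 2) = 600`, the largest one needed.
  have hharm : (harmonic (Fintype.card S) : ℝ) ≤ 5 / 2 * l := by
    have := harmonic_le_one_add_log (Fintype.card S)
    linarith
  have hH : (Nat.log 2 (Fintype.card S) : ℝ) ≤ 3 / 2 * l := by
    have h1 : (2 : ℝ) ^ Nat.log 2 (Fintype.card S) ≤ Fintype.card S := by
      exact_mod_cast Nat.pow_log_le_self 2 (by omega)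
    have h2 := Real.log_le_log (by positivity) h1
    rw [Real.log_pow] at h2
    have h3 : (0 : ℝ) ≤ Nat.log 2 (Fintype.card S) := Nat.cast_nonneg _
    nlinarith
  refine hsum.trans ?_
  have h1 : 5 * (48 * harmonic (Fintype.card S) * M.connectionCost) ≤
      600 * l * M.connectionCost := by
    have := mul_le_mul_of_nonneg_right hharm hc0
    linarith
  have h2 : (5 * (Nat.log 2 (Fintype.card S) : ℝ) + 1) * M.delayCost ≤ 600 * l * M.delayCost :=
    mul_le_mul_of_nonneg_right (by linarith) hd0
  have h3 := mul_le_mul_of_nonneg_left (add_le_add h1 h2) hcard.le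
  unfold PerfectMatching.cost
  linarith

end MatchingWithDelays

end

theorem theorem1 :
    ∃ C : ℝ, 0 < C ∧
      ∀ (S : Type*) [Fintype S] [PseudoMetricSpace S], 2 ≤ Fintype.card S →
        (∃ A : MatchingWithDelays.RandomizedAlgorithm MatchingWithDelays.mpmd S,
          A.IsCompetitive (C * Real.log (Fintype.card S))) ∧
        (∃ A : MatchingWithDelays.RandomizedAlgorithm MatchingWithDelays.mbpmd S,
          A.IsCompetitive (C * Real.log (Fintype.card S))) :=
  ⟨600, by norm_num, fun S _ _ hS =>
    ⟨MatchingWithDelays.exists_competitive MatchingWithDelays.parityCharges S hS,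
      MatchingWithDelays.exists_competitive MatchingWithDelays.polarityCharges S hS⟩⟩
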